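/- Let $E$ be the $\mathbb{S}$-bimodule over $\mathbb{C}$ generated by a product $\mu\colon (x,y)\mapsto xy$ (one output, two inputs) and a coproduct $\Delta\colon x\mapsto x'\otimes x''$ (two outputs, one input), both without symmetry. Let $\mathcal{F}(E)$ be the free properad on $E$ and $\mathcal{F}^{(k)}(E)$ its component of weight $k$. In biarity $(m,n)$ this component has as a basis the isomorphism classes of connected directed graphs without oriented cycles, with $n$ numbered global inputs, $m$ numbered global outputs and $k$ vertices, each labelled by $\mu$ or $\Delta$, the inputs and outputs of each vertex being ordered; these classes are called monomials. For $a=(a_1,a_2,a_3,a_4)\in\mathbb{C}^4$, let $\mathcal{P}_a$ be the quotient of $\mathcal{F}(E)$ by the ideal generated by associativity, coassociativity and the relation $$\between_a:\quad \Delta(xy) - a_1\, x'\otimes x''y - a_2\, xy'\otimes y'' - a_3\, x'y\otimes x'' - a_4\, y'\otimes xy''.$$ Consider the rewriting rules $$(xy)z\to x(yz),\qquad (\Delta\otimes\mathrm{id})\Delta\to(\mathrm{id}\otimes\Delta)\Delta,$$ $$\Delta(xy)\to a_1\, x'\otimes x''y + a_2\, xy'\otimes y'' + a_3\, x'y\otimes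 x'' + a_4\, y'\otimes xy''$$ on $\mathcal{F}^{(2)}(E)$. They induce a rewriting relation on $\mathcal{F}^{(3)}(E)$: if $M$ is a monomial containing the left-hand side of a rule as a subgraph, if $r$ is the linear combination obtained from $M$ by replacing this subgraph by the right-hand side, if $c\in\mathbb{C}\setminus\{0\}$, and if $M$ does not occur in $u$, then $cM+u\to cr+u$. Let $\twoheadrightarrow$ be the reflexive transitive closure of $\to$. One says that $\mathcal{P}_a$ induces a confluent system (in weight $3$) if, in each biarity of $\mathcal{F}^{(3)}(E)$, whenever $y\twoheadleftarrow x\twoheadrightarrow z$ there is $w$ with $y\twoheadrightarrow w\twoheadleftarrow z$. Proposition. Let $a=(a_1,a_2,a_3,a_4)\in\mathbb{C}^4$, let $\tilde a:=(a_2,a_1,a_3,a_4)$, and let $$C:=\{a\in\mathbb{C}^4 \mid a_i=a_i^2 \text{ for all } i\in\{1,2,3,4\}, \text{ and } a_2a_4=a_1a_3=0\}.$$ The properad $\mathcal{P}_a$ induces a confluent system if and only if $a\in C$ and $\tilde a\in C$. Equivalently, $\mathcal{P}_a$ induces a confluent system if and only if $a_i=a_i^2$ for all $i\in\{1,2,3,4\}$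 and $a_1a_3=a_1a_4=a_2a_3=a_2a_4=0$. -/

import Mathlib

namespace Properad

/-- The generators of `E`: a product `μ` (one output, two inputs) and a coproduct `Δ`
(two outputs, one input), without symmetry. -/
inductive Gen
  | prod
  | coprod
  deriving DecidableEq

/-- Number of inputs of a generator. -/
def Gen.numIn : Gen → ℕ
  | .prod => 2
  | .coprod => 1

/-- Number of outputs of a generator. -/
def Gen.numOut : Gen → ℕ
  | .prod => 1
  | .coprod => 2

/-- Where a wire can start: at `Sum.inl (v, i)`, the output number `i` of the vertex `v`, or at
`Sum.inr i`, the global input number `i`. Ports are numbered `0, 1` from left to right. -/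
abbrev Source (k n : ℕ) := (Fin k × Fin 2) ⊕ Fin n

/-- Where a wire can end: at `Sum.inl (v, i)`, the input number `i` of the vertex `v`, or at
`Sum.inr j`, the global output number `j`. -/
abbrev Target (k m : ℕ) := (Fin k × Fin 2) ⊕ Fin m

/-- The sources that exist when the vertices carry the generators `lab`. -/
def IsSource {k n : ℕ} (lab : Fin k → Gen) : Source k n → Prop
  | Sum.inl (v, i) => i.val < (lab v).numOut
  | Sum.inr _ => True

/-- The targets that exist when the vertices carry the generators `lab`. -/
def IsTarget {k m : ℕ} (lab : Fin k → Gen) : Target k m → Prop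
  | Sum.inl (v, i) => i.val < (lab v).numIn
  | Sum.inr _ => True

/-- The nodes of a graph: its vertices, its global inputs and its global outputs. -/
abbrev Node (k m n : ℕ) := Fin k ⊕ (Fin n ⊕ Fin m)

/-- The node that carries a source. -/
def sourceNode {k n : ℕ} (m : ℕ) : Source k n → Node k m n
  | Sum.inl x => Sum.inl x.1
  | Sum.inr i => Sum.inr (Sum.inl i)

/-- The node that carries a target. -/
def targetNode {k m : ℕ} (n : ℕ) : Target k m → Node k m n
  | Sum.inl x => Sum.inl x.1
  | Sum.inr j => Sum.inr (Sum.inr j)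

/-- There is a wire from the vertex `v` to the vertex `w`. -/
def VertexLink {k m n : ℕ} (wire : Source k n → Target k m → Prop) (v w : Fin k) : Prop :=
  ∃ i j : Fin 2, wire (Sum.inl (v, i)) (Sum.inl (w, j))

/-- There is a wire from the node `x` to the node `y`. -/
def NodeLink {k m n : ℕ} (wire : Source k n → Target k m → Prop) (x y : Node k m n) : Prop :=
  ∃ s t, wire s t ∧ sourceNode m s = x ∧ targetNode n t = y

/-- A connected directed graph without oriented cycles, with `k` vertices labelled by the
generators (their inputs and outputs being ordered), with `n` numbered global inputs and `m`
numbered global outputs: a graph monomial of weight `k` and biarity `(m, n)`. -/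
structure Graph (k m n : ℕ) where
  lab : Fin k → Gen
  wire : Source k n → Target k m → Prop
  wire_valid : ∀ s t, wire s t → IsSource lab s ∧ IsTarget lab t
  source_unique : ∀ s, IsSource lab s → ∃! t, wire s t
  target_unique : ∀ t, IsTarget lab t → ∃! s, wire s t
  acyclic : ∀ v, ¬ Relation.TransGen (VertexLink wire) v v
  nonempty : Nonempty (Node k m n)
  connected : ∀ x y, Relation.EqvGen (NodeLink wire) x y

/-- The map induced on sources or targets by a map of vertices. -/
def mapPort {k l : ℕ} (f : Fin k → Fin l) (x : Fin k × Fin 2) : Fin l × Fin 2 := (f x.1, x.2)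

/-- Two graphs are isomorphic when they differ by a renumbering of the vertices that respects the
generators, the order of the inputs and outputs at each vertex, and the global inputs and
outputs. -/
def Graph.Iso {k m n : ℕ} (G G' : Graph k m n) : Prop :=
  ∃ σ : Equiv.Perm (Fin k), (∀ v, G'.lab (σ v) = G.lab v) ∧
    ∀ s t, G'.wire (Sum.map (mapPort σ) id s) (Sum.map (mapPort σ) id t) ↔ G.wire s t

theorem mapPort_symm {k : ℕ} {A : Type} (σ : Equiv.Perm (Fin k)) (s : (Fin k × Fin 2) ⊕ A) :
    Sum.map (mapPort σ) id (Sum.map (mapPort σ.symm) id s) = s := by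
  rcases s with ⟨v, i⟩ | i <;> simp [mapPort]

theorem mapPort_trans {k : ℕ} {A : Type} (σ τ : Equiv.Perm (Fin k)) (s : (Fin k × Fin 2) ⊕ A) :
    Sum.map (mapPort (σ.trans τ)) id s = Sum.map (mapPort τ) id (Sum.map (mapPort σ) id s) := by
  rcases s with ⟨v, i⟩ | i <;> simp [mapPort]

theorem mapPort_refl {k : ℕ} {A : Type} (s : (Fin k × Fin 2) ⊕ A) :
    Sum.map (mapPort (Equiv.refl (Fin k))) id s = s := by
  rcases s with ⟨v, i⟩ | i <;> simp [mapPort]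

theorem Graph.iso_equivalence (k m n : ℕ) : Equivalence (Graph.Iso (k := k) (m := m) (n := n)) where
  refl G := ⟨Equiv.refl _, fun _ => rfl, fun s t => by rw [mapPort_refl, mapPort_refl]⟩
  symm := by
    rintro G G' ⟨σ, h₁, h₂⟩
    refine ⟨σ.symm, fun v => ?_, fun s t => ?_⟩
    · rw [← h₁, Equiv.apply_symm_apply]
    · rw [← h₂, mapPort_symm, mapPort_symm]
  trans := by
    rintro G G' G'' ⟨σ, h₁, h₂⟩ ⟨τ, h₃, h₄⟩
    refine ⟨σ.trans τ, fun v => ?_, fun s t => ?_⟩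
    · rw [Equiv.trans_apply, h₃, h₁]
    · rw [mapPort_trans, mapPort_trans, h₄, h₂]

instance Graph.setoid (k m n : ℕ) : Setoid (Graph k m n) := ⟨Graph.Iso, Graph.iso_equivalence k m n⟩

/-- The monomials of weight `k` and biarity `(m, n)`: graphs up to isomorphism. -/
abbrev Monomial (k m n : ℕ) := Quotient (Graph.setoid k m n)

/-- The component of weight `k` and biarity `(m, n)` of the free properad on `E`. As `E` is a sum
of a regular representation of `S₂` in biarity `(1, 2)`, generated by the product, and one in
biarity `(2, 1)`, generated by the coproduct, this is the vector space with the isomorphism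
classes of graphs as a basis; symmetric groups act by renumbering the global inputs and outputs. -/
abbrev FreeProperad (k m n : ℕ) := Monomial k m n →₀ ℂ

/-- The monomial of a graph, as an element of the free properad. -/
noncomputable def Graph.toFree {k m n : ℕ} (G : Graph k m n) : FreeProperad k m n :=
  Finsupp.single (Quotient.mk _ G) 1

/-! ### The monomials of weight two that occur in the relations -/

theorem acyclic_of_rank {k : ℕ} {r : Fin k → Fin k → Prop} (h : Fin k → ℕ)
    (hr : ∀ v w, r v w → h v < h w) (v : Fin k) : ¬ Relation.TransGen r v v := by
  have key : ∀ x y, Relation.TransGen r x y → h x < h y := by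
    intro x y hxy
    induction hxy with
    | single h1 => exact hr _ _ h1
    | tail _ h2 ih => exact ih.trans (hr _ _ h2)
  exact fun hv => lt_irrefl _ (key v v hv)

theorem connected_of_root {A : Type} {r : A → A → Prop} (x₀ : A)
    (h : ∀ x, x = x₀ ∨ (r x x₀ ∨ r x₀ x) ∨ ∃ y, (r x y ∨ r y x) ∧ (r y x₀ ∨ r x₀ y))
    (x y : A) : Relation.EqvGen r x y := by
  have one : ∀ x y, (r x y ∨ r y x) → Relation.EqvGen r x y := by
    rintro x y (h | h)
    · exact .rel _ _ h
    · exact .symm _ _ (.rel _ _ h)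
  have key : ∀ x, Relation.EqvGen r x x₀ := by
    intro x
    rcases h x with rfl | h | ⟨y, h₁, h₂⟩
    · exact .refl _
    · exact one _ _ h
    · exact .trans _ _ _ (one _ _ h₁) (one _ _ h₂)
  exact .trans _ _ _ (key x) (.symm _ _ (key y))

theorem existsUnique_of {A B : Type} {p : A → Prop} {r : A → B → Prop}
    (h : ∀ s, p s → ∃ t, r s t ∧ ∀ y, r s y → y = t) (s : A) (hs : p s) : ∃! t, r s t :=
  h s hs

instance {k n : ℕ} (lab : Fin k → Gen) : DecidablePred (IsSource (n := n) lab)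
  | Sum.inl (v, i) => inferInstanceAs (Decidable (i.val < (lab v).numOut))
  | Sum.inr _ => inferInstanceAs (Decidable True)

instance {k m : ℕ} (lab : Fin k → Gen) : DecidablePred (IsTarget (m := m) lab)
  | Sum.inl (v, i) => inferInstanceAs (Decidable (i.val < (lab v).numIn))
  | Sum.inr _ => inferInstanceAs (Decidable True)

/-- The relation given by a list of wires. -/
def wiresOf {k m n : ℕ} (W : List (Source k n × Target k m)) (s : Source k n) (t : Target k m) :
    Prop := (s, t) ∈ W

instance {k m n : ℕ} (W : List (Source k n × Target k m)) (s : Source k n) (t : Target k m) :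
    Decidable (wiresOf W s t) := 
  @List.instDecidableMemOfLawfulBEq _ instBEqOfDecidableEq inferInstance (s, t) W

instance {k m n : ℕ} (W : List (Source k n × Target k m)) (v w : Fin k) :
    Decidable (VertexLink (wiresOf W) v w) :=
  inferInstanceAs (Decidable (∃ i j : Fin 2, wiresOf W (Sum.inl (v, i)) (Sum.inl (w, j))))

instance {k m n : ℕ} (W : List (Source k n × Target k m)) (x y : Node k m n) :
    Decidable (NodeLink (wiresOf W) x y) :=
  inferInstanceAs (Decidable (∃ s t, wiresOf W s t ∧ sourceNode m s = x ∧ targetNode n t = y))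

/-- Port `i` of the vertex `v`. -/
abbrev port {k : ℕ} {A : Type} (v : Fin k) (i : Fin 2) : (Fin k × Fin 2) ⊕ A := Sum.inl (v, i)

/-- Global input or output number `i`. -/
abbrev leg {k l : ℕ} (i : Fin l) : (Fin k × Fin 2) ⊕ Fin l := Sum.inr i

/-- `(x y) z` -/
def leftComb : Graph 2 1 3 where
  lab := ![.prod, .prod]
  wire := wiresOf [(leg 0, port 0 0), (leg 1, port 0 1), (port 0 0, port 1 0),
    (leg 2, port 1 1), (port 1 0, leg 0)]
  wire_valid := by decide
  source_unique := existsUnique_of (by decide)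
  target_unique := existsUnique_of (by decide)
  acyclic := acyclic_of_rank ![0, 1] (by decide)
  nonempty := ⟨Sum.inl 0⟩
  connected := connected_of_root (Sum.inl 0) (by decide)

/-- `x (y z)` -/
def rightComb : Graph 2 1 3 where
  lab := ![.prod, .prod]
  wire := wiresOf [(leg 0, port 1 0), (leg 1, port 0 0), (leg 2, port 0 1),
    (port 0 0, port 1 1), (port 1 0, leg 0)]
  wire_valid := by decide
  source_unique := existsUnique_of (by decide)
  target_unique := existsUnique_of (by decide)
  acyclic := acyclic_of_rank ![0, 1] (by decide)
  nonempty := ⟨Sum.inl 0⟩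
  connected := connected_of_root (Sum.inl 0) (by decide)

/-- `(Δ ⊗ id) Δ` -/
def leftCocomb : Graph 2 3 1 where
  lab := ![.coprod, .coprod]
  wire := wiresOf [(leg 0, port 0 0), (port 0 0, port 1 0), (port 1 0, leg 0),
    (port 1 1, leg 1), (port 0 1, leg 2)]
  wire_valid := by decide
  source_unique := existsUnique_of (by decide)
  target_unique := existsUnique_of (by decide)
  acyclic := acyclic_of_rank ![0, 1] (by decide)
  nonempty := ⟨Sum.inl 0⟩
  connected := connected_of_root (Sum.inl 0) (by decide)

/-- `(id ⊗ Δ) Δ` -/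
def rightCocomb : Graph 2 3 1 where
  lab := ![.coprod, .coprod]
  wire := wiresOf [(leg 0, port 0 0), (port 0 0, leg 0), (port 0 1, port 1 0),
    (port 1 0, leg 1), (port 1 1, leg 2)]
  wire_valid := by decide
  source_unique := existsUnique_of (by decide)
  target_unique := existsUnique_of (by decide)
  acyclic := acyclic_of_rank ![0, 1] (by decide)
  nonempty := ⟨Sum.inl 0⟩
  connected := connected_of_root (Sum.inl 0) (by decide)

/-- `Δ (x y)`. In this monomial and in the four following ones, of biarity `(2, 2)`, vertex `0` is
the product, vertex `1` is the coproduct, `x` and `y` are the global inputs `0` and `1`, the tensor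
factors are the global outputs, and `Δ x = x' ⊗ x''`. -/
def coprodOfProd : Graph 2 2 2 where
  lab := ![.prod, .coprod]
  wire := wiresOf [(leg 0, port 0 0), (leg 1, port 0 1), (port 0 0, port 1 0),
    (port 1 0, leg 0), (port 1 1, leg 1)]
  wire_valid := by decide
  source_unique := existsUnique_of (by decide)
  target_unique := existsUnique_of (by decide)
  acyclic := acyclic_of_rank ![0, 1] (by decide)
  nonempty := ⟨Sum.inl 0⟩
  connected := connected_of_root (Sum.inl 0) (by decide)

/-- `x' ⊗ x'' y` -/
def term₁ : Graph 2 2 2 where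
  lab := ![.prod, .coprod]
  wire := wiresOf [(leg 0, port 1 0), (port 1 0, leg 0), (port 1 1, port 0 0),
    (leg 1, port 0 1), (port 0 0, leg 1)]
  wire_valid := by decide
  source_unique := existsUnique_of (by decide)
  target_unique := existsUnique_of (by decide)
  acyclic := acyclic_of_rank ![1, 0] (by decide)
  nonempty := ⟨Sum.inl 0⟩
  connected := connected_of_root (Sum.inl 0) (by decide)

/-- `x y' ⊗ y''` -/
def term₂ : Graph 2 2 2 where
  lab := ![.prod, .coprod]
  wire := wiresOf [(leg 1, port 1 0), (leg 0, port 0 0), (port 1 0, port 0 1),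
    (port 0 0, leg 0), (port 1 1, leg 1)]
  wire_valid := by decide
  source_unique := existsUnique_of (by decide)
  target_unique := existsUnique_of (by decide)
  acyclic := acyclic_of_rank ![1, 0] (by decide)
  nonempty := ⟨Sum.inl 0⟩
  connected := connected_of_root (Sum.inl 0) (by decide)

/-- `x' y ⊗ x''` -/
def term₃ : Graph 2 2 2 where
  lab := ![.prod, .coprod]
  wire := wiresOf [(leg 0, port 1 0), (port 1 0, port 0 0), (leg 1, port 0 1),
    (port 0 0, leg 0), (port 1 1, leg 1)]
  wire_valid := by decide
  source_unique := existsUnique_of (by decide)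
  target_unique := existsUnique_of (by decide)
  acyclic := acyclic_of_rank ![1, 0] (by decide)
  nonempty := ⟨Sum.inl 0⟩
  connected := connected_of_root (Sum.inl 0) (by decide)

/-- `y' ⊗ x y''` -/
def term₄ : Graph 2 2 2 where
  lab := ![.prod, .coprod]
  wire := wiresOf [(leg 1, port 1 0), (port 1 0, leg 0), (leg 0, port 0 0),
    (port 1 1, port 0 1), (port 0 0, leg 1)]
  wire_valid := by decide
  source_unique := existsUnique_of (by decide)
  target_unique := existsUnique_of (by decide)
  acyclic := acyclic_of_rank ![1, 0] (by decide)
  nonempty := ⟨Sum.inl 0⟩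
  connected := connected_of_root (Sum.inl 0) (by decide)

/-! ### Replacing a subgraph, and the rewriting system -/

section Replace

variable {l p q k m n : ℕ}

/-- `s` and `s'` are the same source outside of the copy, with vertices `f 0, f 1, …`, of `H` in
one graph and of `H'` in another one: a source not in the copy, or the source of the same output of
`H` and `H'`. -/
def SameSource (H H' : Graph l p q) (f : Fin l ↪ Fin k) (s s' : Source k n) : Prop :=
  (∃ i : Fin n, s = Sum.inr i ∧ s' = Sum.inr i) ∨
  (∃ v i, v ∉ Set.range f ∧ s = Sum.inl (v, i) ∧ s' = Sum.inl (v, i)) ∨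
  ∃ (j : Fin p) (x x' : Fin l × Fin 2), H.wire (Sum.inl x) (Sum.inr j) ∧
    H'.wire (Sum.inl x') (Sum.inr j) ∧ s = Sum.inl (mapPort f x) ∧ s' = Sum.inl (mapPort f x')

/-- The analogue of `SameSource` for targets, with the inputs of `H` and `H'`. -/
def SameTarget (H H' : Graph l p q) (f : Fin l ↪ Fin k) (t t' : Target k m) : Prop :=
  (∃ j : Fin m, t = Sum.inr j ∧ t' = Sum.inr j) ∨
  (∃ v i, v ∉ Set.range f ∧ t = Sum.inl (v, i) ∧ t' = Sum.inl (v, i)) ∨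
  ∃ (i : Fin q) (x x' : Fin l × Fin 2), H.wire (Sum.inr i) (Sum.inl x) ∧
    H'.wire (Sum.inr i) (Sum.inl x') ∧ t = Sum.inl (mapPort f x) ∧ t' = Sum.inl (mapPort f x')

/-- `f` embeds `H` in `G` as the subgraph with vertices `f 0, f 1, …`: it respects the generators
and sends the inner wires of `H` to wires of `G`. -/
structure Occurs (H : Graph l p q) (f : Fin l ↪ Fin k) (G : Graph k m n) : Prop where
  lab_eq : ∀ v, G.lab (f v) = H.lab v
  inner : ∀ x y, H.wire (Sum.inl x) (Sum.inl y) →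
    G.wire (Sum.inl (mapPort f x)) (Sum.inl (mapPort f y))

/-- `G'` is obtained from `G` by replacing the subgraph `H` with vertices `f 0, f 1, …` by `H'`,
each input and each output of `H'` being connected in the same way to the rest of the graph as the
input or the output of `H` with the same number. -/
structure Replace (H H' : Graph l p q) (f : Fin l ↪ Fin k) (G G' : Graph k m n) : Prop where
  occurs : Occurs H f G
  occurs' : Occurs H' f G'
  lab_outer : ∀ v, v ∉ Set.range f → G'.lab v = G.lab v
  outer : ∀ s s' t t', SameSource H H' f s s' → SameTarget H H' f t t' →
    (G.wire s t ↔ G'.wire s' t')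

end Replace

/-- The rewriting of monomials induced in weight `k` by the three rules of weight two
`(x y) z → x (y z)`, `(Δ ⊗ id) Δ → (id ⊗ Δ) Δ` and
`Δ (x y) → a₁ x' ⊗ x'' y + a₂ x y' ⊗ y'' + a₃ x' y ⊗ x'' + a₄ y' ⊗ x y''`
(`a i` is the parameter number `i + 1`). -/
inductive MonomialRule (a : Fin 4 → ℂ) {k m n : ℕ} : Monomial k m n → FreeProperad k m n → Prop
  | assoc (f : Fin 2 ↪ Fin k) (G G' : Graph k m n) (h : Replace leftComb rightComb f G G') :
      MonomialRule a (Quotient.mk _ G) G'.toFree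
  | coassoc (f : Fin 2 ↪ Fin k) (G G' : Graph k m n) (h : Replace leftCocomb rightCocomb f G G') :
      MonomialRule a (Quotient.mk _ G) G'.toFree
  | between (f : Fin 2 ↪ Fin k) (G G₁ G₂ G₃ G₄ : Graph k m n)
      (h₁ : Replace coprodOfProd term₁ f G G₁) (h₂ : Replace coprodOfProd term₂ f G G₂)
      (h₃ : Replace coprodOfProd term₃ f G G₃) (h₄ : Replace coprodOfProd term₄ f G G₄) :
      MonomialRule a (Quotient.mk _ G)
        (a 0 • G₁.toFree + a 1 • G₂.toFree + a 2 • G₃.toFree + a 3 • G₄.toFree)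

/-- The rewriting relation on the vector space: one monomial `M`, occurring in an element with the
nonzero coefficient `c`, is replaced by its image `r` under a rule. -/
def Rewrites (a : Fin 4 → ℂ) {k m n : ℕ} (x y : FreeProperad k m n) : Prop :=
  ∃ (M : Monomial k m n) (r : FreeProperad k m n) (c : ℂ) (u : FreeProperad k m n),
    MonomialRule a M r ∧ c ≠ 0 ∧ M ∉ u.support ∧ x = Finsupp.single M c + u ∧ y = c • r + u

/-- A rewriting system is confluent when any two elements that the same element rewrites to, in
finitely many steps, rewrite to a common element. -/
def Confluent {A : Type*} (r : A → A → Prop) : Prop :=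
  ∀ x y z, Relation.ReflTransGen r x y → Relation.ReflTransGen r x z →
    ∃ w, Relation.ReflTransGen r y w ∧ Relation.ReflTransGen r z w

/-- The properad with parameters `a` induces a confluent system (in weight three): the rewriting
system on the weight three part of the free properad is confluent, in every biarity. -/
def InducesConfluentSystem (a : Fin 4 → ℂ) : Prop :=
  ∀ m n : ℕ, Confluent (Rewrites a (k := 3) (m := m) (n := n))

/-- The set `C` of parameters. -/
def setC : Set (Fin 4 → ℂ) :=
  {a | (∀ i, a i = a i ^ 2) ∧ a 1 * a 3 = 0 ∧ a 0 * a 2 = 0}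

end Properad

/-! Termination: `Monomial.rank` attaches to each monomial of weight three a natural number that
drops under every rule (`MonomialRule.rank_lt`). Choosing one rule at each reducible monomial
therefore defines a linear map `normalize` with values in the combinations of irreducible monomials,
and every element rewrites to its image (`rewrites_normalize`). Confluence then means that
`normalize` agrees on any two one-step reducts of the same monomial (`normalize_eq_of_confluent`,
`confluent_of_normalize_eq`).

Critical monomials: a left-hand side is the same thing as a wire from the first output of one vertex
to the first input of another, the labels not being a coproduct followed by a product. A port
carries one wire, so two different left-hand sides in a graph with three vertices follow each other
in a chain (`chain_or_eq`), and a chain has no other inner wire. Up to renumbering there remain `((x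
y) z) w`, its dual, `Δ ((x y) z)` and `(Δ ⊗ id) Δ (x y)` (`Graph.IsChain.exists_code`).

Comparison: the first two critical pairs close for all parameters, by the pentagon and its dual. For
`Δ ((x y) z)` the two normal forms differ by eight distinct irreducible monomials, with coefficients
`±(aᵢ - aᵢ²)`, `a₂a₄` twice and `-a₁a₃` twice (`Code.nf_prod₂coprod`). Turning graphs upside down
exchanges the product and the coproduct, swaps the first two terms of the third rule and fixes the
other two. This is where `ã` comes from: the last critical monomial gives the same list with `a₁`
and `a₂` exchanged (`Code.nf_prodCoprod₂`). Distinct irreducible monomials are linearly independent,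
so confluence holds exactly when all these coefficients vanish.

The individual replacements, isomorphisms and irreducibility checks are finite; they are decided by
evaluation on graphs given by lists of wires (`Code`). -/

namespace Properad

open Relation

/-! ### Renumbering of vertices and of global inputs and outputs -/

section Relabel

variable {k m n m' n' : ℕ}

/-- The bijection on sources or targets induced by bijections of vertices and of legs. -/
def portEquiv {A B : Type} (σ : Equiv.Perm (Fin k)) (α : A ≃ B) :
    (Fin k × Fin 2) ⊕ A ≃ (Fin k × Fin 2) ⊕ B :=
  Equiv.sumCongr (Equiv.prodCongr σ (Equiv.refl _)) α

@[simp] theorem portEquiv_inl {A B : Type} (σ : Equiv.Perm (Fin k)) (α : A ≃ B)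
    (x : Fin k × Fin 2) : portEquiv σ α (Sum.inl x) = Sum.inl (σ x.1, x.2) := rfl

@[simp] theorem portEquiv_inr {A B : Type} (σ : Equiv.Perm (Fin k)) (α : A ≃ B) (i : A) :
    portEquiv σ α (Sum.inr i) = Sum.inr (α i) := rfl

@[simp] theorem portEquiv_symm_inl {A B : Type} (σ : Equiv.Perm (Fin k)) (α : A ≃ B)
    (x : Fin k × Fin 2) : (portEquiv σ α).symm (Sum.inl x) = Sum.inl (σ.symm x.1, x.2) := rfl

@[simp] theorem portEquiv_symm_inr {A B : Type} (σ : Equiv.Perm (Fin k)) (α : A ≃ B) (i : B) :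
    (portEquiv σ α).symm (Sum.inr i) = Sum.inr (α.symm i) := rfl

theorem isSource_portEquiv (lab : Fin k → Gen) (σ : Equiv.Perm (Fin k)) (α : Fin n ≃ Fin n')
    (s : Source k n') :
    IsSource (fun v => lab (σ.symm v)) s ↔ IsSource lab ((portEquiv σ α).symm s) := by
  rcases s with ⟨v, i⟩ | i <;> rfl

theorem isTarget_portEquiv (lab : Fin k → Gen) (σ : Equiv.Perm (Fin k)) (β : Fin m ≃ Fin m')
    (t : Target k m') :
    IsTarget (fun v => lab (σ.symm v)) t ↔ IsTarget lab ((portEquiv σ β).symm t) := by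
  rcases t with ⟨v, i⟩ | i <;> rfl

theorem sourceNode_portEquiv (σ : Equiv.Perm (Fin k)) (α : Fin n ≃ Fin n') (β : Fin m ≃ Fin m')
    (s : Source k n) : sourceNode m' (portEquiv σ α s) =
      Equiv.sumCongr σ (Equiv.sumCongr α β) (sourceNode m s) := by
  rcases s with ⟨v, i⟩ | i <;> rfl

theorem targetNode_portEquiv (σ : Equiv.Perm (Fin k)) (α : Fin n ≃ Fin n') (β : Fin m ≃ Fin m')
    (t : Target k m) : targetNode n' (portEquiv σ β t) =
      Equiv.sumCongr σ (Equiv.sumCongr α β) (targetNode n t) := by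
  rcases t with ⟨v, i⟩ | i <;> rfl

/-- Renumbering the vertices and the global inputs and outputs of a graph. -/
def Graph.relabel (G : Graph k m n) (σ : Equiv.Perm (Fin k)) (α : Fin n ≃ Fin n')
    (β : Fin m ≃ Fin m') : Graph k m' n' where
  lab v := G.lab (σ.symm v)
  wire s t := G.wire ((portEquiv σ α).symm s) ((portEquiv σ β).symm t)
  wire_valid s t h := by
    rw [isSource_portEquiv G.lab σ α, isTarget_portEquiv G.lab σ β]
    exact G.wire_valid _ _ h
  source_unique s h := by
    rw [isSource_portEquiv G.lab σ α] at h
    obtain ⟨t, h₁, h₂⟩ := G.source_unique _ h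
    exact ⟨portEquiv σ β t, by simpa using h₁, fun y hy => by simp [← h₂ _ hy]⟩
  target_unique t h := by
    rw [isTarget_portEquiv G.lab σ β] at h
    obtain ⟨s, h₁, h₂⟩ := G.target_unique _ h
    exact ⟨portEquiv σ α s, by simpa using h₁, fun y hy => by simp [← h₂ _ hy]⟩
  acyclic v h := by
    refine G.acyclic (σ.symm v) (TransGen.lift σ.symm (r := VertexLink _) ?_ _ _ h)
    rintro x y ⟨i, j, hij⟩
    exact ⟨i, j, hij⟩
  nonempty := G.nonempty.map (Equiv.sumCongr σ (Equiv.sumCongr α β))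
  connected x y := by
    let e := Equiv.sumCongr σ (Equiv.sumCongr α β)
    have key : ∀ x y, EqvGen (NodeLink G.wire) x y →
        EqvGen (NodeLink fun s t => G.wire ((portEquiv σ α).symm s) ((portEquiv σ β).symm t))
          (e x) (e y) := by
      intro x y h
      induction h with
      | rel x y h =>
        obtain ⟨s, t, h, rfl, rfl⟩ := h
        exact .rel _ _ ⟨portEquiv σ α s, portEquiv σ β t, by simpa using h,
          sourceNode_portEquiv σ α β s, targetNode_portEquiv σ α β t⟩
      | refl x => exact .refl _
      | symm _ _ _ ih => exact .symm _ _ ih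
      | trans _ _ _ _ _ ih₁ ih₂ => exact .trans _ _ _ ih₁ ih₂
    simpa using key _ _ (G.connected (e.symm x) (e.symm y))

theorem Graph.ext' {G G' : Graph k m n} (h : G.lab = G'.lab)
    (h' : ∀ s t, G.wire s t ↔ G'.wire s t) : G = G' := by
  have h'' : G.wire = G'.wire := by ext s t; exact h' s t
  cases G; cases G'; cases h; cases h''; rfl

theorem mapPort_eq_portEquiv {A : Type} (σ : Equiv.Perm (Fin k)) (s : (Fin k × Fin 2) ⊕ A) :
    Sum.map (mapPort σ) id s = portEquiv σ (Equiv.refl A) s := by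
  rcases s with ⟨v, i⟩ | i <;> rfl

theorem Graph.iso_iff_relabel (G G' : Graph k m n) :
    G.Iso G' ↔ ∃ σ, G' = G.relabel σ (Equiv.refl _) (Equiv.refl _) := by
  constructor
  · rintro ⟨σ, h₁, h₂⟩
    refine ⟨σ, Graph.ext' (funext fun v => ?_) fun s t => ?_⟩
    · simp [relabel, ← h₁]
    · simp [relabel, ← h₂, mapPort_eq_portEquiv]
  · rintro ⟨σ, rfl⟩
    refine ⟨σ, fun v => by simp [relabel], fun s t => ?_⟩
    simp [relabel, mapPort_eq_portEquiv]

theorem Graph.mk_relabel (G : Graph k m n) (σ : Equiv.Perm (Fin k)) :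
    (Quotient.mk _ (G.relabel σ (Equiv.refl _) (Equiv.refl _)) : Monomial k m n) =
      Quotient.mk _ G :=
  (Quotient.sound ((G.iso_iff_relabel _).2 ⟨σ, rfl⟩)).symm

theorem Graph.relabel_relabel {m'' n'' : ℕ} (G : Graph k m n) (σ τ : Equiv.Perm (Fin k))
    (α : Fin n ≃ Fin n') (β : Fin m ≃ Fin m') (α' : Fin n' ≃ Fin n'') (β' : Fin m' ≃ Fin m'') :
    (G.relabel σ α β).relabel τ α' β' = G.relabel (σ.trans τ) (α.trans α') (β.trans β') := by
  refine Graph.ext' rfl fun s t => ?_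
  rcases s with ⟨v, i⟩ | i <;> rcases t with ⟨w, j⟩ | j <;> rfl

theorem Graph.relabel_refl (G : Graph k m n) :
    G.relabel (Equiv.refl _) (Equiv.refl _) (Equiv.refl _) = G := by
  refine Graph.ext' rfl fun s t => ?_
  rcases s with ⟨v, i⟩ | i <;> rcases t with ⟨w, j⟩ | j <;> rfl

theorem Graph.mk_relabel_congr {G G' : Graph k m n} (h : G.Iso G') (α : Fin n ≃ Fin n')
    (β : Fin m ≃ Fin m') (σ : Equiv.Perm (Fin k)) :
    (Quotient.mk _ (G.relabel σ α β) : Monomial k m' n') = Quotient.mk _ (G'.relabel σ α β) := by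
  obtain ⟨τ, rfl⟩ := (G.iso_iff_relabel _).1 h
  rw [relabel_relabel]
  -- The isomorphism `τ` becomes its conjugate by `σ`.
  refine Quotient.sound (((G.relabel σ α β).iso_iff_relabel _).2 ⟨σ.symm.trans (τ.trans σ), ?_⟩)
  rw [relabel_relabel]
  congr 1
  ext; simp

end Relabel

/-! ### Graphs are determined by their inner wires, up to the numbering of the legs -/

section Structure

variable {k m n : ℕ}

theorem Graph.source_eq (G : Graph k m n) {s s' : Source k n} {t : Target k m}
    (h : G.wire s t) (h' : G.wire s' t) : s = s' :=
  (G.target_unique t (G.wire_valid _ _ h).2).unique h h'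

theorem Graph.target_eq (G : Graph k m n) {s : Source k n} {t t' : Target k m}
    (h : G.wire s t) (h' : G.wire s t') : t = t' :=
  (G.source_unique s (G.wire_valid _ _ h).1).unique h h'

/-- A graph with a vertex has no wire from a global input to a global output. -/
theorem Graph.not_wire_inr_inr (G : Graph k m n) (v : Fin k) (i : Fin n) (j : Fin m) :
    ¬ G.wire (Sum.inr i) (Sum.inr j) := by
  intro h
  -- A leg carries a single wire, so the two ends of such a wire would be closed under links and
  -- could not be connected to `v`.
  let P : Node k m n → Prop := fun x => x = Sum.inr (Sum.inl i) ∨ x = Sum.inr (Sum.inr j)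
  have key : ∀ x y, EqvGen (NodeLink G.wire) x y → (P x ↔ P y) := by
    intro x y hxy
    induction hxy with
    | rel x y hxy =>
      obtain ⟨s, t, hst, rfl, rfl⟩ := hxy
      constructor
      · intro hs
        rcases s with s | s
        · simp [P, sourceNode] at hs
        · obtain rfl : s = i := by simpa [P, sourceNode] using hs
          obtain rfl := G.target_eq h hst
          exact .inr rfl
      · intro ht
        rcases t with t | t
        · simp [P, targetNode] at ht
        · obtain rfl : t = j := by simpa [P, targetNode] using ht
          obtain rfl := G.source_eq h hst
          exact .inl rfl
    | refl x => rfl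
    | symm _ _ _ ih => exact ih.symm
    | trans _ _ _ _ _ ih₁ ih₂ => exact ih₁.trans ih₂
  have := (key _ _ (G.connected (Sum.inr (Sum.inl i)) (Sum.inl v))).1 (.inl rfl)
  simp [P] at this

theorem Graph.exists_source_of_output (G : Graph k m n) (v : Fin k) (j : Fin m) :
    ∃ x, G.wire (Sum.inl x) (Sum.inr j) := by
  obtain ⟨s, hs, -⟩ := G.target_unique (Sum.inr j) trivial
  rcases s with x | i
  · exact ⟨x, hs⟩
  · exact absurd hs (G.not_wire_inr_inr v i j)

theorem Graph.exists_target_of_input (G : Graph k m n) (v : Fin k) (i : Fin n) :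
    ∃ x, G.wire (Sum.inr i) (Sum.inl x) := by
  obtain ⟨t, ht, -⟩ := G.source_unique (Sum.inr i) trivial
  rcases t with x | j
  · exact ⟨x, ht⟩
  · exact absurd ht (G.not_wire_inr_inr v i j)

/-- Two graphs with the same generators and the same inner wires differ by a renumbering of the
global inputs and outputs. -/
theorem Graph.exists_relabel_eq {m' n' : ℕ} (G : Graph k m n) (K : Graph k m' n') (v : Fin k)
    (hlab : G.lab = K.lab)
    (hw : ∀ x y, G.wire (Sum.inl x) (Sum.inl y) ↔ K.wire (Sum.inl x) (Sum.inl y)) :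
    ∃ (α : Fin n ≃ Fin n') (β : Fin m ≃ Fin m'), K = G.relabel (Equiv.refl _) α β := by
  -- A port on no inner wire of one graph is on none of the other, so it is attached to a leg in
  -- both. This matches the legs; by symmetry the matching has an inverse.
  have inputs : ∀ {m n m' n' : ℕ} (G : Graph k m n) (K : Graph k m' n'), G.lab = K.lab →
      (∀ x y, G.wire (Sum.inl x) (Sum.inl y) ↔ K.wire (Sum.inl x) (Sum.inl y)) →
      ∀ i, ∃ i', ∃ x, G.wire (Sum.inr i) (Sum.inl x) ∧ K.wire (Sum.inr i') (Sum.inl x) := by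
    intro m n m' n' G K hlab hw i
    obtain ⟨x, hx⟩ := G.exists_target_of_input v i
    have hx' : IsTarget (m := m') K.lab (Sum.inl x) := hlab ▸ (G.wire_valid _ _ hx).2
    obtain ⟨s, hs, -⟩ := K.target_unique _ hx'
    rcases s with y | i'
    · cases G.source_eq hx ((hw _ _).2 hs)
    · exact ⟨i', x, hx, hs⟩
  have outputs : ∀ {m n m' n' : ℕ} (G : Graph k m n) (K : Graph k m' n'), G.lab = K.lab →
      (∀ x y, G.wire (Sum.inl x) (Sum.inl y) ↔ K.wire (Sum.inl x) (Sum.inl y)) →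
      ∀ j, ∃ j', ∃ x, G.wire (Sum.inl x) (Sum.inr j) ∧ K.wire (Sum.inl x) (Sum.inr j') := by
    intro m n m' n' G K hlab hw j
    obtain ⟨x, hx⟩ := G.exists_source_of_output v j
    have hx' : IsSource (n := n') K.lab (Sum.inl x) := hlab ▸ (G.wire_valid _ _ hx).1
    obtain ⟨s, hs, -⟩ := K.source_unique _ hx'
    rcases s with y | j'
    · cases G.target_eq hx ((hw _ _).2 hs)
    · exact ⟨j', x, hx, hs⟩
  choose α hα using inputs G K hlab hw
  choose α' hα' using inputs K G hlab.symm fun x y => (hw x y).symm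
  choose β hβ using outputs G K hlab hw
  choose β' hβ' using outputs K G hlab.symm fun x y => (hw x y).symm
  have e₁ : ∀ i, α' (α i) = i := fun i => by
    obtain ⟨x, h₁, h₂⟩ := hα i
    obtain ⟨y, h₃, h₄⟩ := hα' (α i)
    cases K.target_eq h₂ h₃
    exact (Sum.inr.inj (G.source_eq h₁ h₄)).symm
  have e₂ : ∀ i, α (α' i) = i := fun i => by
    obtain ⟨x, h₁, h₂⟩ := hα' i
    obtain ⟨y, h₃, h₄⟩ := hα (α' i)
    cases G.target_eq h₂ h₃
    exact (Sum.inr.inj (K.source_eq h₁ h₄)).symm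
  have e₃ : ∀ i, β' (β i) = i := fun i => by
    obtain ⟨x, h₁, h₂⟩ := hβ i
    obtain ⟨y, h₃, h₄⟩ := hβ' (β i)
    cases K.source_eq h₂ h₃
    exact (Sum.inr.inj (G.target_eq h₁ h₄)).symm
  have e₄ : ∀ i, β (β' i) = i := fun i => by
    obtain ⟨x, h₁, h₂⟩ := hβ' i
    obtain ⟨y, h₃, h₄⟩ := hβ (β' i)
    cases G.source_eq h₂ h₃
    exact (Sum.inr.inj (K.target_eq h₁ h₄)).symm
  refine ⟨⟨α, α', e₁, e₂⟩, ⟨β, β', e₃, e₄⟩, Graph.ext' ?_ fun s t => ?_⟩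
  · exact hlab.symm
  · rcases s with x | i <;> rcases t with y | j
    · exact (hw x y).symm
    · change _ ↔ G.wire (Sum.inl x) (Sum.inr (β' j))
      obtain ⟨y, h₁, h₂⟩ := hβ' j
      constructor
      · intro h
        cases K.source_eq h h₁
        exact h₂
      · intro h
        cases G.source_eq h h₂
        exact h₁
    · change _ ↔ G.wire (Sum.inr (α' i)) (Sum.inl y)
      obtain ⟨x, h₁, h₂⟩ := hα' i
      constructor
      · intro h
        cases K.target_eq h h₁
        exact h₂
      · intro h
        cases G.target_eq h h₂
        exact h₁
    · exact iff_of_false (K.not_wire_inr_inr v _ _) (G.not_wire_inr_inr v _ _)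

end Structure

/-! ### Replacement of a subgraph: equivariance and uniqueness -/

section ReplaceLemmas

variable {l p q k m n m' n' : ℕ}

theorem mapPort_trans_apply (f : Fin l ↪ Fin k) (σ : Equiv.Perm (Fin k)) (x : Fin l × Fin 2) :
    mapPort (f.trans σ.toEmbedding) x = (σ (mapPort f x).1, (mapPort f x).2) := rfl

theorem Occurs.relabel {H : Graph l p q} {f : Fin l ↪ Fin k} {G : Graph k m n}
    (h : Occurs H f G) (σ : Equiv.Perm (Fin k)) (α : Fin n ≃ Fin n') (β : Fin m ≃ Fin m') :
    Occurs H (f.trans σ.toEmbedding) (G.relabel σ α β) where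
  lab_eq v := by simp [Graph.relabel, h.lab_eq]
  inner x y hxy := by
    have := h.inner x y hxy
    simpa [Graph.relabel, mapPort_trans_apply] using this

theorem SameSource.of_relabel {H H' : Graph l p q} {f : Fin l ↪ Fin k} {σ : Equiv.Perm (Fin k)}
    {α : Fin n ≃ Fin n'} {s s' : Source k n'}
    (h : SameSource H H' (f.trans σ.toEmbedding) s s') :
    SameSource H H' f ((portEquiv σ α).symm s) ((portEquiv σ α).symm s') := by
  rcases h with ⟨i, rfl, rfl⟩ | ⟨v, i, hv, rfl, rfl⟩ | ⟨j, x, x', h₁, h₂, rfl, rfl⟩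
  · exact .inl ⟨α.symm i, rfl, rfl⟩
  · refine .inr (.inl ⟨σ.symm v, i, ?_, rfl, rfl⟩)
    rintro ⟨u, hu⟩
    exact hv ⟨u, by simp [hu]⟩
  · exact .inr (.inr ⟨j, x, x', h₁, h₂, by simp [mapPort], by simp [mapPort]⟩)

theorem SameTarget.of_relabel {H H' : Graph l p q} {f : Fin l ↪ Fin k} {σ : Equiv.Perm (Fin k)}
    {β : Fin m ≃ Fin m'} {t t' : Target k m'}
    (h : SameTarget H H' (f.trans σ.toEmbedding) t t') :
    SameTarget H H' f ((portEquiv σ β).symm t) ((portEquiv σ β).symm t') := by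
  rcases h with ⟨i, rfl, rfl⟩ | ⟨v, i, hv, rfl, rfl⟩ | ⟨j, x, x', h₁, h₂, rfl, rfl⟩
  · exact .inl ⟨β.symm i, rfl, rfl⟩
  · refine .inr (.inl ⟨σ.symm v, i, ?_, rfl, rfl⟩)
    rintro ⟨u, hu⟩
    exact hv ⟨u, by simp [hu]⟩
  · exact .inr (.inr ⟨j, x, x', h₁, h₂, by simp [mapPort], by simp [mapPort]⟩)

theorem Replace.relabel {H H' : Graph l p q} {f : Fin l ↪ Fin k} {G G' : Graph k m n}
    (h : Replace H H' f G G') (σ : Equiv.Perm (Fin k)) (α : Fin n ≃ Fin n') (β : Fin m ≃ Fin m') :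
    Replace H H' (f.trans σ.toEmbedding) (G.relabel σ α β) (G'.relabel σ α β) where
  occurs := h.occurs.relabel σ α β
  occurs' := h.occurs'.relabel σ α β
  lab_outer v hv := by
    refine h.lab_outer _ ?_
    rintro ⟨u, hu⟩
    exact hv ⟨u, by simp [hu]⟩
  outer s s' t t' hs ht := h.outer _ _ _ _ hs.of_relabel ht.of_relabel

/-- Together with `Occurs.target_cases`, this splits the ports of the result into those on inner
wires of the new copy and those that correspond to a port of the old graph. The vertex `v₀` rules
out a wire of `H` going straight from an input to an output. -/
theorem Occurs.source_cases {H' : Graph l p q} {f : Fin l ↪ Fin k} {G' : Graph k m n}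
    (h : Occurs H' f G') (H : Graph l p q) (v₀ : Fin l) {s' : Source k n}
    (hs : IsSource G'.lab s') :
    (∃ y z, H'.wire (Sum.inl y) (Sum.inl z) ∧ s' = Sum.inl (mapPort f y)) ∨
      ∃ s, SameSource H H' f s s' := by
  rcases s' with ⟨v, i⟩ | i
  · by_cases hv : v ∈ Set.range f
    · obtain ⟨u, rfl⟩ := hv
      have hu : IsSource (n := q) H'.lab (Sum.inl (u, i)) := by
        simpa [IsSource, h.lab_eq] using hs
      obtain ⟨t, ht, -⟩ := H'.source_unique _ hu
      rcases t with z | j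
      · exact .inl ⟨_, z, ht, rfl⟩
      · obtain ⟨x, hx⟩ := H.exists_source_of_output v₀ j
        exact .inr ⟨_, .inr (.inr ⟨j, x, _, hx, ht, rfl, rfl⟩)⟩
    · exact .inr ⟨_, .inr (.inl ⟨v, i, hv, rfl, rfl⟩)⟩
  · exact .inr ⟨_, .inl ⟨i, rfl, rfl⟩⟩

theorem Occurs.target_cases {H' : Graph l p q} {f : Fin l ↪ Fin k} {G' : Graph k m n}
    (h : Occurs H' f G') (H : Graph l p q) (v₀ : Fin l) {t' : Target k m}
    (ht : IsTarget G'.lab t') :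
    (∃ y z, H'.wire (Sum.inl y) (Sum.inl z) ∧ t' = Sum.inl (mapPort f z)) ∨
      ∃ t, SameTarget H H' f t t' := by
  rcases t' with ⟨v, i⟩ | i
  · by_cases hv : v ∈ Set.range f
    · obtain ⟨u, rfl⟩ := hv
      have hu : IsTarget (m := p) H'.lab (Sum.inl (u, i)) := by
        simpa [IsTarget, h.lab_eq] using ht
      obtain ⟨t, ht, -⟩ := H'.target_unique _ hu
      rcases t with z | j
      · exact .inl ⟨z, _, ht, rfl⟩
      · obtain ⟨x, hx⟩ := H.exists_target_of_input v₀ j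
        exact .inr ⟨_, .inr (.inr ⟨j, x, _, hx, ht, rfl, rfl⟩)⟩
    · exact .inr ⟨_, .inr (.inl ⟨v, i, hv, rfl, rfl⟩)⟩
  · exact .inr ⟨_, .inl ⟨i, rfl, rfl⟩⟩

/-- A wire of the result is either an inner wire of the copy, imposed by `occurs'`, or joins two
ports with counterparts in `G`, where `outer` decides. Nothing is left to choose. -/
theorem Replace.wire_imp {H H' : Graph l p q} {f : Fin l ↪ Fin k} {G G₁ G₂ : Graph k m n}
    (v₀ : Fin l) (h₁ : Replace H H' f G G₁) (h₂ : Replace H H' f G G₂) (s : Source k n)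
    (t : Target k m) (hst : G₁.wire s t) : G₂.wire s t := by
  rcases h₁.occurs'.source_cases H v₀ (G₁.wire_valid _ _ hst).1 with ⟨y, z, hyz, rfl⟩ | ⟨s₀, hs⟩
  · obtain rfl := G₁.target_eq hst (h₁.occurs'.inner _ _ hyz)
    exact h₂.occurs'.inner _ _ hyz
  · rcases h₁.occurs'.target_cases H v₀ (G₁.wire_valid _ _ hst).2 with ⟨y, z, hyz, rfl⟩ | ⟨t₀, ht⟩
    · obtain rfl := G₁.source_eq hst (h₁.occurs'.inner _ _ hyz)
      exact h₂.occurs'.inner _ _ hyz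
    · exact (h₂.outer _ _ _ _ hs ht).1 ((h₁.outer _ _ _ _ hs ht).2 hst)

theorem Replace.unique {H H' : Graph l p q} {f : Fin l ↪ Fin k} {G G₁ G₂ : Graph k m n}
    (v₀ : Fin l) (h₁ : Replace H H' f G G₁) (h₂ : Replace H H' f G G₂) : G₁ = G₂ := by
  refine Graph.ext' (funext fun v => ?_) fun s t => ⟨h₁.wire_imp v₀ h₂ s t, h₂.wire_imp v₀ h₁ s t⟩
  by_cases hv : v ∈ Set.range f
  · obtain ⟨u, rfl⟩ := hv
    rw [h₁.occurs'.lab_eq, h₂.occurs'.lab_eq]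
  · rw [h₁.lab_outer _ hv, h₂.lab_outer _ hv]

end ReplaceLemmas

/-! ### The rules at a given position -/

section Rules

variable {k m n : ℕ}

/-- The rule at the subgraph with vertices `f 0, f 1`, applied to a graph. -/
inductive RuleAt (a : Fin 4 → ℂ) (f : Fin 2 ↪ Fin k) (G : Graph k m n) : FreeProperad k m n → Prop
  | assoc (G' : Graph k m n) (h : Replace leftComb rightComb f G G') : RuleAt a f G G'.toFree
  | coassoc (G' : Graph k m n) (h : Replace leftCocomb rightCocomb f G G') : RuleAt a f G G'.toFree
  | between (G₁ G₂ G₃ G₄ : Graph k m n)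
      (h₁ : Replace coprodOfProd term₁ f G G₁) (h₂ : Replace coprodOfProd term₂ f G G₂)
      (h₃ : Replace coprodOfProd term₃ f G G₃) (h₄ : Replace coprodOfProd term₄ f G G₄) :
      RuleAt a f G (a 0 • G₁.toFree + a 1 • G₂.toFree + a 2 • G₃.toFree + a 3 • G₄.toFree)

theorem Graph.toFree_relabel (G : Graph k m n) (σ : Equiv.Perm (Fin k)) :
    (G.relabel σ (Equiv.refl _) (Equiv.refl _)).toFree = G.toFree := by
  simp only [Graph.toFree, Graph.mk_relabel]

theorem RuleAt.relabel {a : Fin 4 → ℂ} {f : Fin 2 ↪ Fin k} {G : Graph k m n}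
    {r : FreeProperad k m n} (h : RuleAt a f G r) (σ : Equiv.Perm (Fin k)) :
    RuleAt a (f.trans σ.toEmbedding) (G.relabel σ (Equiv.refl _) (Equiv.refl _)) r := by
  cases h with
  | assoc G' h =>
    rw [← G'.toFree_relabel σ]
    exact .assoc _ (h.relabel σ _ _)
  | coassoc G' h =>
    rw [← G'.toFree_relabel σ]
    exact .coassoc _ (h.relabel σ _ _)
  | between G₁ G₂ G₃ G₄ h₁ h₂ h₃ h₄ =>
    rw [← G₁.toFree_relabel σ, ← G₂.toFree_relabel σ, ← G₃.toFree_relabel σ, ← G₄.toFree_relabel σ]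
    exact .between _ _ _ _ (h₁.relabel σ _ _) (h₂.relabel σ _ _) (h₃.relabel σ _ _)
      (h₄.relabel σ _ _)

theorem RuleAt.monomialRule {a : Fin 4 → ℂ} {f : Fin 2 ↪ Fin k} {G : Graph k m n}
    {r : FreeProperad k m n} (h : RuleAt a f G r) : MonomialRule a (Quotient.mk _ G) r := by
  cases h with
  | assoc G' h => exact .assoc f G G' h
  | coassoc G' h => exact .coassoc f G G' h
  | between G₁ G₂ G₃ G₄ h₁ h₂ h₃ h₄ => exact .between f G G₁ G₂ G₃ G₄ h₁ h₂ h₃ h₄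

/-- A rule on a monomial may be witnessed on any representative; the isomorphism carries the
position over to the given one. -/
theorem monomialRule_mk {a : Fin 4 → ℂ} {G : Graph k m n} {r : FreeProperad k m n} :
    MonomialRule a (Quotient.mk _ G) r ↔ ∃ f, RuleAt a f G r := by
  refine ⟨fun h => ?_, fun ⟨f, h⟩ => h.monomialRule⟩
  obtain ⟨K, f, hK, hr⟩ : ∃ (K : Graph k m n) (f : Fin 2 ↪ Fin k),
      (Quotient.mk _ G : Monomial k m n) = Quotient.mk _ K ∧ RuleAt a f K r := by
    generalize hM : (Quotient.mk _ G : Monomial k m n) = M at h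
    cases h with
    | assoc f K K' h => exact ⟨K, f, rfl, .assoc _ h⟩
    | coassoc f K K' h => exact ⟨K, f, rfl, .coassoc _ h⟩
    | between f K G₁ G₂ G₃ G₄ h₁ h₂ h₃ h₄ => exact ⟨K, f, rfl, .between _ _ _ _ h₁ h₂ h₃ h₄⟩
  obtain ⟨σ, rfl⟩ := (K.iso_iff_relabel G).1 (Quotient.exact hK.symm)
  exact ⟨_, hr.relabel σ⟩

/-- The vertices `u` and `v` carry the left-hand side of a rule. -/
def Graph.Redex (G : Graph k m n) (u v : Fin k) : Prop :=
  G.wire (Sum.inl (u, 0)) (Sum.inl (v, 0)) ∧ ¬ (G.lab u = .coprod ∧ G.lab v = .prod)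

/-- In all three left-hand sides the inner wire goes from port `0` of vertex `0` to port `0` of
vertex `1`. This one-wire criterion is what makes overlaps easy to classify. -/
theorem RuleAt.redex {a : Fin 4 → ℂ} {f : Fin 2 ↪ Fin k} {G : Graph k m n}
    {r : FreeProperad k m n} (h : RuleAt a f G r) : G.Redex (f 0) (f 1) := by
  cases h with
  | assoc G' h =>
    refine ⟨h.occurs.inner (0, 0) (1, 0) (by change (_ ∈ _); simp), ?_⟩
    rw [h.occurs.lab_eq, h.occurs.lab_eq]; decide
  | coassoc G' h =>
    refine ⟨h.occurs.inner (0, 0) (1, 0) (by change (_ ∈ _); simp), ?_⟩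
    rw [h.occurs.lab_eq, h.occurs.lab_eq]; decide
  | between G₁ G₂ G₃ G₄ h₁ h₂ h₃ h₄ =>
    refine ⟨h₁.occurs.inner (0, 0) (1, 0) (by change (_ ∈ _); simp), ?_⟩
    rw [h₁.occurs.lab_eq, h₁.occurs.lab_eq]; decide

/-- The labels of the two vertices tell the three left-hand sides apart, and each replacement has
only one result. -/
theorem RuleAt.unique {a : Fin 4 → ℂ} {f : Fin 2 ↪ Fin k} {G : Graph k m n}
    {r r' : FreeProperad k m n} (h : RuleAt a f G r) (h' : RuleAt a f G r') : r = r' := by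
  have aux : ∀ {p q p' q' : ℕ} {H : Graph 2 p q} {H' : Graph 2 p' q'}, Occurs H f G →
      Occurs H' f G → H.lab = H'.lab :=
    fun h h' => funext fun v => by rw [← h.lab_eq, ← h'.lab_eq]
  cases h with
  | assoc K h =>
    cases h' with
    | assoc K' h' => rw [h.unique 0 h']
    | coassoc K' h' => exact absurd (aux h.occurs h'.occurs) (by decide)
    | between _ _ _ _ h' => exact absurd (aux h.occurs h'.occurs) (by decide)
  | coassoc K h =>
    cases h' with
    | assoc K' h' => exact absurd (aux h.occurs h'.occurs) (by decide)
    | coassoc K' h' => rw [h.unique 0 h']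
    | between _ _ _ _ h' => exact absurd (aux h.occurs h'.occurs) (by decide)
  | between _ _ _ _ h₁ h₂ h₃ h₄ =>
    cases h' with
    | assoc K' h' => exact absurd (aux h₁.occurs h'.occurs) (by decide)
    | coassoc K' h' => exact absurd (aux h₁.occurs h'.occurs) (by decide)
    | between _ _ _ _ h₁' h₂' h₃' h₄' =>
      rw [h₁.unique 0 h₁', h₂.unique 0 h₂', h₃.unique 0 h₃', h₄.unique 0 h₄']

end Rules

/-! ### A rank that witnesses termination -/

section Rank

/-- The relation `e` links an output of `u` to an input of `v`. -/
def HasEdge (e : Fin 3 × Fin 2 → Fin 3 × Fin 2 → Bool) (u v : Fin 3) : Prop :=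
  ∃ i j, e (u, i) (v, j) = true

/-- There is a path from `u` to `v`. -/
def HasPath (e : Fin 3 × Fin 2 → Fin 3 × Fin 2 → Bool) (u v : Fin 3) : Prop :=
  HasEdge e u v ∨ ∃ w, HasEdge e u w ∧ HasEdge e w v

/-- There is a path from `u` to the left input of `v`. -/
def HasPathToLeft (e : Fin 3 × Fin 2 → Fin 3 × Fin 2 → Bool) (u v : Fin 3) : Prop :=
  (∃ i, e (u, i) (v, 0) = true) ∨ ∃ w, HasEdge e u w ∧ ∃ i, e (w, i) (v, 0) = true

/-- There is a path from the left output of `u` to `v`. -/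
def HasPathFromLeft (e : Fin 3 × Fin 2 → Fin 3 × Fin 2 → Bool) (u v : Fin 3) : Prop :=
  (∃ j, e (u, 0) (v, j) = true) ∨ ∃ w, (∃ j, e (u, 0) (w, j) = true) ∧ HasEdge e w v

instance (e u v) : Decidable (HasEdge e u v) :=
  inferInstanceAs (Decidable (∃ i j, e (u, i) (v, j) = true))

instance (e u v) : Decidable (HasPath e u v) :=
  inferInstanceAs (Decidable (HasEdge e u v ∨ ∃ w, HasEdge e u w ∧ HasEdge e w v))

instance (e u v) : Decidable (HasPathToLeft e u v) :=
  inferInstanceAs (Decidable ((∃ i, e (u, i) (v, 0) = true) ∨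
    ∃ w, HasEdge e u w ∧ ∃ i, e (w, i) (v, 0) = true))

instance (e u v) : Decidable (HasPathFromLeft e u v) :=
  inferInstanceAs (Decidable ((∃ j, e (u, 0) (v, j) = true) ∨
    ∃ w, (∃ j, e (u, 0) (w, j) = true) ∧ HasEdge e w v))

/-- The contribution of the pair of vertices `u, v` to the rank. -/
def pairRank (lab : Fin 3 → Gen) (e : Fin 3 × Fin 2 → Fin 3 × Fin 2 → Bool) (u v : Fin 3) : ℕ :=
  match lab u, lab v with
  -- There are nine ordered pairs, and the other kinds contribute at most 1 each. Hence 20 makes the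
  -- loss of a single path from a product to a coproduct outweigh them all.
  | .prod, .coprod => if HasPath e u v then 20 else 0
  | .prod, .prod => if HasPathToLeft e u v then 1 else 0
  | .coprod, .coprod => if HasPathFromLeft e u v then 1 else 0
  | .coprod, .prod => 0

/-- A number that decreases under the three rules. -/
def rankOf (lab : Fin 3 → Gen) (e : Fin 3 × Fin 2 → Fin 3 × Fin 2 → Bool) : ℕ :=
  ∑ u, ∑ v, pairRank lab e u v

theorem rankOf_perm (lab : Fin 3 → Gen) (e : Fin 3 × Fin 2 → Fin 3 × Fin 2 → Bool)
    (σ : Equiv.Perm (Fin 3)) :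
    rankOf (fun v => lab (σ v)) (fun x y => e (σ x.1, x.2) (σ y.1, y.2)) = rankOf lab e := by
  have h₂ : ∀ u v, pairRank (fun v => lab (σ v)) (fun x y => e (σ x.1, x.2) (σ y.1, y.2)) u v =
      pairRank lab e (σ u) (σ v) := by
    intro u v
    have p₁ : HasPath (fun x y => e (σ x.1, x.2) (σ y.1, y.2)) u v ↔ HasPath e (σ u) (σ v) :=
      or_congr Iff.rfl (σ.surjective.exists (p := fun w =>
        HasEdge e (σ u) w ∧ HasEdge e w (σ v))).symm
    have p₂ : HasPathToLeft (fun x y => e (σ x.1, x.2) (σ y.1, y.2)) u v ↔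
        HasPathToLeft e (σ u) (σ v) :=
      or_congr Iff.rfl (σ.surjective.exists (p := fun w =>
        HasEdge e (σ u) w ∧ ∃ i, e (w, i) (σ v, 0) = true)).symm
    have p₃ : HasPathFromLeft (fun x y => e (σ x.1, x.2) (σ y.1, y.2)) u v ↔
        HasPathFromLeft e (σ u) (σ v) :=
      or_congr Iff.rfl (σ.surjective.exists (p := fun w =>
        (∃ j, e (σ u, 0) (w, j) = true) ∧ HasEdge e w (σ v))).symm
    simp only [pairRank, p₁, p₂, p₃]
  simp only [rankOf, h₂]
  rw [← Equiv.sum_comp σ fun u => ∑ v, pairRank lab e u v]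
  exact Finset.sum_congr rfl fun u _ => Equiv.sum_comp σ fun v => pairRank lab e (σ u) v

open Classical in
/-- The inner wires of a graph. -/
noncomputable def Graph.innerWires {k m n : ℕ} (G : Graph k m n) (x y : Fin k × Fin 2) : Bool :=
  decide (G.wire (Sum.inl x) (Sum.inl y))

/-- The rank of a graph of weight three. -/
noncomputable def Graph.rank {m n : ℕ} (G : Graph 3 m n) : ℕ := rankOf G.lab G.innerWires

theorem Graph.rank_relabel {m n : ℕ} (G : Graph 3 m n) (σ : Equiv.Perm (Fin 3)) :
    (G.relabel σ (Equiv.refl _) (Equiv.refl _)).rank = G.rank :=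
  rankOf_perm G.lab G.innerWires σ.symm

/-- The rank of a monomial of weight three. -/
noncomputable def Monomial.rank {m n : ℕ} : Monomial 3 m n → ℕ :=
  Quotient.lift Graph.rank fun G G' h => by
    obtain ⟨σ, rfl⟩ := (G.iso_iff_relabel G').1 h
    exact (G.rank_relabel σ).symm

theorem Monomial.rank_mk {m n : ℕ} (G : Graph 3 m n) :
    Monomial.rank (Quotient.mk _ G) = G.rank := rfl

end Rank

/-! ### The position of the third vertex relative to a left-hand side -/

section Model

variable {p q m n : ℕ}

/-- The vertices `0, 1` among `0, 1, 2`. -/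
def firstTwo : Fin 2 ↪ Fin 3 := Fin.castSuccEmb

/-- The inner wires of a graph of weight three, the vertices `0, 1` of which form a copy of `H`:
`b o i` tells whether the output `o` of the vertex `2` goes to the input `i` of `H`, and `d j o`
whether the output `j` of `H` goes to the input `o` of the vertex `2`. -/
def modelWires (H : Graph 2 p q) [∀ s t, Decidable (H.wire s t)] (b : Fin 2 → Fin q → Bool)
    (d : Fin p → Fin 2 → Bool) (x y : Fin 3 × Fin 2) : Bool :=
  if hx : x.1.val < 2 then
    if hy : y.1.val < 2 then decide (H.wire (Sum.inl (⟨x.1, hx⟩, x.2)) (Sum.inl (⟨y.1, hy⟩, y.2)))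
    else decide (∃ j, H.wire (Sum.inl (⟨x.1, hx⟩, x.2)) (Sum.inr j) ∧ d j y.2 = true)
  else
    if hy : y.1.val < 2 then
      decide (∃ i, H.wire (Sum.inr i) (Sum.inl (⟨y.1, hy⟩, y.2)) ∧ b x.2 i = true)
    else false

/-- `G` has a copy of `H` at the vertices `0, 1`, connected to the vertex `2` as given by
`b` and `d`. -/
structure ModelledBy (H : Graph 2 p q) (b : Fin 2 → Fin q → Bool) (d : Fin p → Fin 2 → Bool)
    (G : Graph 3 m n) : Prop where
  occurs : Occurs H firstTwo G
  above : ∀ o i y, H.wire (Sum.inr i) (Sum.inl y) →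
    (G.wire (Sum.inl (2, o)) (Sum.inl (mapPort firstTwo y)) ↔ b o i = true)
  below : ∀ j o x, H.wire (Sum.inl x) (Sum.inr j) →
    (G.wire (Sum.inl (mapPort firstTwo x)) (Sum.inl (2, o)) ↔ d j o = true)
  back : ∀ i j x y, H.wire (Sum.inl x) (Sum.inr j) → H.wire (Sum.inr i) (Sum.inl y) →
    ¬ G.wire (Sum.inl (mapPort firstTwo x)) (Sum.inl (mapPort firstTwo y))

theorem mapPort_firstTwo (v : Fin 3) (hv : v.val < 2) (i : Fin 2) :
    mapPort firstTwo (⟨v, hv⟩, i) = (v, i) := rfl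

theorem two_notMem_range_firstTwo : (2 : Fin 3) ∉ Set.range firstTwo := by
  rintro ⟨u, hu⟩
  revert u; decide

theorem mapPort_injective {k l : ℕ} (f : Fin l ↪ Fin k) : Function.Injective (mapPort f) := by
  rintro ⟨u, i⟩ ⟨v, j⟩ h
  simpa [mapPort] using h

/-- Each port of the copy is on an inner wire of `H` or corresponds to a leg of `H`. In the second
case the wire is governed by `b` or `d`, or excluded by `back`; acyclicity excludes a loop at the
vertex `2`. The inner wires thus depend on finite data only. -/
theorem ModelledBy.innerWires_eq {H : Graph 2 p q} [∀ s t, Decidable (H.wire s t)]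
    {b : Fin 2 → Fin q → Bool} {d : Fin p → Fin 2 → Bool} {G : Graph 3 m n}
    (h : ModelledBy H b d G) : G.innerWires = modelWires H b d := by
  funext ⟨v, i⟩ ⟨w, j⟩
  have hsrc : ∀ x t, G.wire (Sum.inl (mapPort firstTwo x)) t → ∃ t', H.wire (Sum.inl x) t' := by
    intro x t hx
    have : IsSource (n := q) H.lab (Sum.inl x) := by
      have := (G.wire_valid _ _ hx).1
      simpa [IsSource, mapPort, h.occurs.lab_eq] using this
    exact (H.source_unique _ this).exists
  have htgt : ∀ s y, G.wire s (Sum.inl (mapPort firstTwo y)) → ∃ s', H.wire s' (Sum.inl y) := by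
    intro s y hy
    have : IsTarget (m := p) H.lab (Sum.inl y) := by
      have := (G.wire_valid _ _ hy).2
      simpa [IsTarget, mapPort, h.occurs.lab_eq] using this
    exact (H.target_unique _ this).exists
  have two : ∀ {v : Fin 3}, ¬ v.val < 2 → v = 2 := by decide
  have ne : ∀ z o, mapPort firstTwo z ≠ ((2 : Fin 3), (o : Fin 2)) := fun z o hz =>
    two_notMem_range_firstTwo ⟨z.1, congrArg Prod.fst hz⟩
  unfold Graph.innerWires modelWires
  by_cases hv : v.val < 2 <;> by_cases hw : w.val < 2 <;> simp only [hv, hw, dif_pos, dif_neg,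
    not_false_eq_true, decide_eq_decide]
  · constructor
    · intro hG
      rw [← mapPort_firstTwo v hv, ← mapPort_firstTwo w hw] at hG
      obtain ⟨t, ht⟩ := hsrc _ _ hG
      obtain ⟨s, hs⟩ := htgt _ _ hG
      rcases t with z | j'
      · have := G.target_eq hG (h.occurs.inner _ _ ht)
        rwa [mapPort_injective _ (Sum.inl.inj this)]
      · rcases s with z | i'
        · have := G.source_eq hG (h.occurs.inner _ _ hs)
          rwa [mapPort_injective _ (Sum.inl.inj this)]
        · exact absurd hG (h.back _ _ _ _ ht hs)
    · exact fun hH => h.occurs.inner _ _ hH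
  · obtain rfl := two hw
    constructor
    · intro hG
      rw [← mapPort_firstTwo v hv] at hG
      obtain ⟨t, ht⟩ := hsrc _ _ hG
      rcases t with z | j'
      · exact absurd (Sum.inl.inj (G.target_eq (h.occurs.inner _ _ ht) hG)) (ne z j)
      · exact ⟨j', ht, (h.below _ _ _ ht).1 hG⟩
    · rintro ⟨j', ht, hd⟩
      exact (h.below _ _ _ ht).2 hd
  · obtain rfl := two hv
    constructor
    · intro hG
      rw [← mapPort_firstTwo w hw] at hG
      obtain ⟨t, ht⟩ := htgt _ _ hG
      rcases t with z | j'
      · exact absurd (Sum.inl.inj (G.source_eq (h.occurs.inner _ _ ht) hG)) (ne z i)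
      · exact ⟨j', ht, (h.above _ _ _ ht).1 hG⟩
    · rintro ⟨j', ht, hd⟩
      exact (h.above _ _ _ ht).2 hd
  · obtain rfl := two hv
    obtain rfl := two hw
    rw [decide_eq_false_iff_not]
    exact fun hG => G.acyclic _ (.single ⟨_, _, hG⟩)

theorem ModelledBy.lab_eq {H : Graph 2 p q} {b : Fin 2 → Fin q → Bool} {d : Fin p → Fin 2 → Bool}
    {G : Graph 3 m n} (h : ModelledBy H b d G) : G.lab = ![H.lab 0, H.lab 1, G.lab 2] := by
  funext v
  fin_cases v
  · exact h.occurs.lab_eq 0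
  · exact h.occurs.lab_eq 1
  · rfl

theorem Replace.modelledBy {H H' : Graph 2 p q} {G G' : Graph 3 m n}
    (h : Replace H H' firstTwo G G') {b : Fin 2 → Fin q → Bool} {d : Fin p → Fin 2 → Bool}
    (hG : ModelledBy H b d G) : ModelledBy H' b d G' where
  occurs := h.occurs'
  above o i y hy := by
    obtain ⟨x, hx⟩ := H.exists_target_of_input 0 i
    rw [← hG.above o i x hx]
    exact (h.outer _ _ _ _ (.inr (.inl ⟨2, o, two_notMem_range_firstTwo, rfl, rfl⟩))
      (.inr (.inr ⟨i, x, y, hx, hy, rfl, rfl⟩))).symm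
  below j o y hy := by
    obtain ⟨x, hx⟩ := H.exists_source_of_output 0 j
    rw [← hG.below j o x hx]
    exact (h.outer _ _ _ _ (.inr (.inr ⟨j, x, y, hx, hy, rfl, rfl⟩))
      (.inr (.inl ⟨2, o, two_notMem_range_firstTwo, rfl, rfl⟩))).symm
  back i j x y hx hy hw := by
    obtain ⟨x', hx'⟩ := H.exists_source_of_output 0 j
    obtain ⟨y', hy'⟩ := H.exists_target_of_input 0 i
    exact hG.back _ _ _ _ hx' hy' ((h.outer _ _ _ _ (.inr (.inr ⟨j, x', x, hx', hx, rfl, rfl⟩))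
      (.inr (.inr ⟨i, y', y, hy', hy, rfl, rfl⟩))).2 hw)

/-- In `H`, there is a path from each input to each output. -/
def FullyLinked (H : Graph 2 p q) : Prop :=
  ∀ i j x y, H.wire (Sum.inl x) (Sum.inr j) → H.wire (Sum.inr i) (Sum.inl y) →
    y.1 = x.1 ∨ ∃ i' j' : Fin 2, H.wire (Sum.inl (y.1, i')) (Sum.inl (x.1, j'))

/-- If the vertex `2` both fed the copy and were fed by it, a path through the copy would close an
oriented cycle. So `b` or `d` is zero, and the two families can be checked separately. -/
theorem Occurs.exists_modelledBy {H : Graph 2 p q} (hH : FullyLinked H) {G : Graph 3 m n}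
    (h : Occurs H firstTwo G) :
    ∃ b d, ModelledBy H b d G ∧ ((∀ o i, b o i = false) ∨ ∀ j o, d j o = false) := by
  classical
  choose y hy using H.exists_target_of_input 0
  choose x hx using H.exists_source_of_output 0
  have link : ∀ i j, ReflTransGen (VertexLink G.wire) (firstTwo (y i).1) (firstTwo (x j).1) := by
    intro i j
    rcases hH i j _ _ (hx j) (hy i) with h' | ⟨i', j', h'⟩
    · rw [h']
    · exact .single ⟨i', j', h.inner _ _ h'⟩
  refine ⟨fun o i => decide (G.wire (Sum.inl (2, o)) (Sum.inl (mapPort firstTwo (y i)))),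
    fun j o => decide (G.wire (Sum.inl (mapPort firstTwo (x j))) (Sum.inl (2, o))), ?_, ?_⟩
  · refine ⟨h, fun o i z hz => ?_, fun j o z hz => ?_, fun i j x' y' hx' hy' hw => ?_⟩
    · rw [decide_eq_true_iff, Sum.inl.inj (H.target_eq hz (hy i))]
    · rw [decide_eq_true_iff, Sum.inl.inj (H.source_eq hz (hx j))]
    · rw [Sum.inl.inj (H.target_eq hy' (hy i)), Sum.inl.inj (H.source_eq hx' (hx j))] at hw
      exact G.acyclic _ (TransGen.head' ⟨_, _, hw⟩ (link i j))
  · simp only [decide_eq_false_iff_not]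
    by_contra! hcon
    obtain ⟨⟨o, i, h₁⟩, j, o', h₂⟩ := hcon
    exact G.acyclic 2 (TransGen.head' ⟨_, _, h₁⟩ ((link i j).tail ⟨_, _, h₂⟩))

instance (s t) : Decidable (leftComb.wire s t) := inferInstanceAs (Decidable (wiresOf _ s t))
instance (s t) : Decidable (rightComb.wire s t) := inferInstanceAs (Decidable (wiresOf _ s t))
instance (s t) : Decidable (leftCocomb.wire s t) := inferInstanceAs (Decidable (wiresOf _ s t))
instance (s t) : Decidable (rightCocomb.wire s t) := inferInstanceAs (Decidable (wiresOf _ s t))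
instance (s t) : Decidable (coprodOfProd.wire s t) := inferInstanceAs (Decidable (wiresOf _ s t))
instance (s t) : Decidable (term₁.wire s t) := inferInstanceAs (Decidable (wiresOf _ s t))
instance (s t) : Decidable (term₂.wire s t) := inferInstanceAs (Decidable (wiresOf _ s t))
instance (s t) : Decidable (term₃.wire s t) := inferInstanceAs (Decidable (wiresOf _ s t))
instance (s t) : Decidable (term₄.wire s t) := inferInstanceAs (Decidable (wiresOf _ s t))

end Model

/-! ### The rules decrease the rank -/

section Decrease

variable {m n : ℕ}

/-- Replacing `H` by `H'` in a graph of weight three makes the rank smaller. -/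
def RankDecreases {p q : ℕ} (H H' : Graph 2 p q) [∀ s t, Decidable (H.wire s t)]
    [∀ s t, Decidable (H'.wire s t)] : Prop :=
  (∀ b : Fin 2 → Fin q → Bool, ∀ g ∈ [Gen.prod, Gen.coprod],
    rankOf ![H.lab 0, H.lab 1, g] (modelWires H' b fun _ _ => false) <
      rankOf ![H.lab 0, H.lab 1, g] (modelWires H b fun _ _ => false)) ∧
  (∀ d : Fin p → Fin 2 → Bool, ∀ g ∈ [Gen.prod, Gen.coprod],
    rankOf ![H.lab 0, H.lab 1, g] (modelWires H' (fun _ _ => false) d) <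
      rankOf ![H.lab 0, H.lab 1, g] (modelWires H (fun _ _ => false) d))

instance {p q : ℕ} (H H' : Graph 2 p q) [∀ s t, Decidable (H.wire s t)]
    [∀ s t, Decidable (H'.wire s t)] : Decidable (RankDecreases H H') :=
  inferInstanceAs (Decidable (_ ∧ _))

/-- The rank does not depend on the numbering, so the copy may be moved to the vertices `0, 1`. The
only remaining data are `b` or `d` and the label of the third vertex, a finite check that is the
content of `RankDecreases`. -/
theorem Replace.rank_lt {p q : ℕ} {H H' : Graph 2 p q} [∀ s t, Decidable (H.wire s t)]
    [∀ s t, Decidable (H'.wire s t)] {f : Fin 2 ↪ Fin 3} {G G' : Graph 3 m n}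
    (h : Replace H H' f G G') (hlink : FullyLinked H) (hlab : H'.lab = H.lab)
    (hdec : RankDecreases H H') : G'.rank < G.rank := by
  obtain ⟨σ, h₀, h₁⟩ : ∃ σ : Equiv.Perm (Fin 3), σ (f 0) = 0 ∧ σ (f 1) = 1 := by
    have key : ∀ u v : Fin 3, u ≠ v → ∃ σ : Equiv.Perm (Fin 3), σ u = 0 ∧ σ v = 1 := by decide
    exact key _ _ (f.injective.ne (by decide))
  have hf : f.trans σ.toEmbedding = firstTwo := by
    ext u
    fin_cases u
    · simp [h₀, firstTwo]
    · simp [h₁, firstTwo]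
  rw [← G.rank_relabel σ, ← G'.rank_relabel σ]
  replace h := h.relabel σ (Equiv.refl _) (Equiv.refl _)
  rw [hf] at h
  generalize G.relabel σ (Equiv.refl _) (Equiv.refl _) = G at h
  generalize G'.relabel σ (Equiv.refl _) (Equiv.refl _) = G' at h
  obtain ⟨b, d, hG, hbd⟩ := h.occurs.exists_modelledBy hlink
  have hG' := h.modelledBy hG
  have h₂ : G'.lab 2 = G.lab 2 := h.lab_outer _ two_notMem_range_firstTwo
  unfold Graph.rank
  rw [hG.innerWires_eq, hG'.innerWires_eq, hG.lab_eq, hG'.lab_eq, h₂, hlab]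
  have hg : G.lab 2 ∈ [Gen.prod, Gen.coprod] := by cases G.lab 2 <;> simp
  rcases hbd with hb | hd
  · obtain rfl : b = fun _ _ => false := by ext o i; simp [hb]
    exact hdec.2 d _ hg
  · obtain rfl : d = fun _ _ => false := by ext o i; simp [hd]
    exact hdec.1 b _ hg

instance {p q : ℕ} (H : Graph 2 p q) [∀ s t, Decidable (H.wire s t)] :
    Decidable (FullyLinked H) := by
  unfold FullyLinked
  infer_instance

theorem fullyLinked_leftComb : FullyLinked leftComb := by decide +kernel

theorem fullyLinked_leftCocomb : FullyLinked leftCocomb := by decide +kernel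

theorem fullyLinked_coprodOfProd : FullyLinked coprodOfProd := by decide +kernel

theorem rankDecreases_assoc : RankDecreases leftComb rightComb := by decide +kernel

theorem rankDecreases_coassoc : RankDecreases leftCocomb rightCocomb := by decide +kernel

theorem rankDecreases_between₁ : RankDecreases coprodOfProd term₁ := by decide +kernel

theorem rankDecreases_between₂ : RankDecreases coprodOfProd term₂ := by decide +kernel

theorem rankDecreases_between₃ : RankDecreases coprodOfProd term₃ := by decide +kernel

theorem rankDecreases_between₄ : RankDecreases coprodOfProd term₄ := by decide +kernel

theorem Graph.mem_support_toFree {k : ℕ} {G : Graph k m n} {M : Monomial k m n}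
    (h : M ∈ G.toFree.support) : M = Quotient.mk _ G := by
  by_contra hne
  exact Finsupp.mem_support_iff.1 h (Finsupp.single_eq_of_ne hne)

theorem RuleAt.rank_lt {a : Fin 4 → ℂ} {f : Fin 2 ↪ Fin 3} {G : Graph 3 m n}
    {r : FreeProperad 3 m n} (h : RuleAt a f G r) {M : Monomial 3 m n} (hM : M ∈ r.support) :
    M.rank < G.rank := by
  have : DecidableEq (Monomial 3 m n) := Classical.decEq _
  cases h with
  | assoc G' h =>
    rw [Graph.mem_support_toFree hM, Monomial.rank_mk]
    exact h.rank_lt fullyLinked_leftComb rfl rankDecreases_assoc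
  | coassoc G' h =>
    rw [Graph.mem_support_toFree hM, Monomial.rank_mk]
    exact h.rank_lt fullyLinked_leftCocomb rfl rankDecreases_coassoc
  | between G₁ G₂ G₃ G₄ h₁ h₂ h₃ h₄ =>
    have smul : ∀ {c : ℂ} {G : Graph 3 m n}, M ∈ (c • G.toFree).support → M = Quotient.mk _ G :=
      fun h => Graph.mem_support_toFree (Finsupp.support_smul h)
    rcases Finset.mem_union.1 (Finsupp.support_add hM) with hM | hM
    · rcases Finset.mem_union.1 (Finsupp.support_add hM) with hM | hM
      · rcases Finset.mem_union.1 (Finsupp.support_add hM) with hM | hM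
        · rw [smul hM, Monomial.rank_mk]
          exact h₁.rank_lt fullyLinked_coprodOfProd rfl rankDecreases_between₁
        · rw [smul hM, Monomial.rank_mk]
          exact h₂.rank_lt fullyLinked_coprodOfProd rfl rankDecreases_between₂
      · rw [smul hM, Monomial.rank_mk]
        exact h₃.rank_lt fullyLinked_coprodOfProd rfl rankDecreases_between₃
    · rw [smul hM, Monomial.rank_mk]
      exact h₄.rank_lt fullyLinked_coprodOfProd rfl rankDecreases_between₄

theorem MonomialRule.rank_lt {a : Fin 4 → ℂ} {M M' : Monomial 3 m n} {r : FreeProperad 3 m n}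
    (h : MonomialRule a M r) (hM : M' ∈ r.support) : M'.rank < M.rank := by
  induction M using Quotient.inductionOn with | h G =>
  obtain ⟨f, hf⟩ := monomialRule_mk.1 h
  rw [Monomial.rank_mk]
  exact hf.rank_lt hM

end Decrease

/-! ### Normal forms, and confluence as agreement of normal forms -/

section NormalForm

variable {m n : ℕ}

/-- A monomial that contains the left-hand side of a rule. -/
def Reducible (a : Fin 4 → ℂ) (M : Monomial 3 m n) : Prop := ∃ r, MonomialRule a M r

open Classical in
/-- The normal form of a monomial, for a choice of a rule at each reducible monomial. -/
noncomputable def normalForm (a : Fin 4 → ℂ) (M : Monomial 3 m n) : FreeProperad 3 m n :=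
  if h : Reducible a M then
    ∑ M' ∈ h.choose.support.attach, h.choose M'.1 • normalForm a M'.1
  else Finsupp.single M 1
termination_by M.rank
decreasing_by exact h.choose_spec.rank_lt M'.2

/-- The linear extension of `normalForm`. -/
noncomputable def normalize (a : Fin 4 → ℂ) :
    FreeProperad 3 m n →ₗ[ℂ] FreeProperad 3 m n :=
  Finsupp.linearCombination ℂ (normalForm a)

theorem normalize_single (a : Fin 4 → ℂ) (M : Monomial 3 m n) (c : ℂ) :
    normalize a (Finsupp.single M c) = c • normalForm a M :=
  Finsupp.linearCombination_single _ _ _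

theorem normalForm_of_not_reducible {a : Fin 4 → ℂ} {M : Monomial 3 m n} (h : ¬ Reducible a M) :
    normalForm a M = Finsupp.single M 1 := by
  rw [normalForm, dif_neg h]

theorem exists_rule_normalForm {a : Fin 4 → ℂ} {M : Monomial 3 m n} (h : Reducible a M) :
    ∃ r, MonomialRule a M r ∧ normalForm a M = normalize a r := by
  refine ⟨h.choose, h.choose_spec, ?_⟩
  rw [normalForm, dif_pos h, normalize, Finsupp.linearCombination_apply, Finsupp.sum,
    Finset.sum_attach h.choose.support fun M' => h.choose M' • normalForm a M']

theorem normalForm_of_unique {a : Fin 4 → ℂ} {M : Monomial 3 m n} {r : FreeProperad 3 m n}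
    (h : MonomialRule a M r) (hu : ∀ r', MonomialRule a M r' → r' = r) :
    normalForm a M = normalize a r := by
  obtain ⟨r', h₁, h₂⟩ := exists_rule_normalForm ⟨r, h⟩
  rw [h₂, hu _ h₁]

theorem normalize_eq_self {a : Fin 4 → ℂ} {x : FreeProperad 3 m n}
    (h : ∀ M ∈ x.support, ¬ Reducible a M) : normalize a x = x := by
  rw [normalize, Finsupp.linearCombination_apply]
  conv_rhs => rw [← Finsupp.sum_single x]
  exact Finsupp.sum_congr fun M hM => by simp [normalForm_of_not_reducible (h M hM)]

theorem not_reducible_of_mem_normalForm {a : Fin 4 → ℂ} {M M' : Monomial 3 m n}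
    (h : M' ∈ (normalForm a M).support) : ¬ Reducible a M' := by
  classical
  induction hk : M.rank using Nat.strong_induction_on generalizing M with | _ k ih =>
  by_cases hM : Reducible a M
  · obtain ⟨r, h₁, h₂⟩ := exists_rule_normalForm hM
    rw [h₂, normalize, Finsupp.linearCombination_apply, Finsupp.sum] at h
    obtain ⟨M₁, hM₁, h₃⟩ := Finset.mem_biUnion.1 (Finsupp.support_finsetSum h)
    exact ih _ (hk ▸ h₁.rank_lt hM₁) (Finsupp.support_smul h₃) rfl
  · rw [normalForm_of_not_reducible hM] at h
    obtain rfl : M' = M := by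
      by_contra hne
      exact Finsupp.mem_support_iff.1 h (Finsupp.single_eq_of_ne hne)
    exact hM

theorem not_reducible_of_mem_normalize {a : Fin 4 → ℂ} {x : FreeProperad 3 m n}
    {M : Monomial 3 m n} (h : M ∈ (normalize a x).support) : ¬ Reducible a M := by
  classical
  rw [normalize, Finsupp.linearCombination_apply, Finsupp.sum] at h
  obtain ⟨M₁, hM₁, h₃⟩ := Finset.mem_biUnion.1 (Finsupp.support_finsetSum h)
  exact not_reducible_of_mem_normalForm (Finsupp.support_smul h₃)

/-- Each element rewrites to its normal form. -/
theorem rewrites_normalize (a : Fin 4 → ℂ) (x : FreeProperad 3 m n) :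
    ReflTransGen (Rewrites a) x (normalize a x) := by
  classical
  -- Double induction: on a strict bound for the ranks of the reducible monomials of `x`, then on
  -- the number of those of the top rank. Rewriting one of the latter only brings in monomials of
  -- smaller rank.
  have key : ∀ (k : ℕ) (x : FreeProperad 3 m n),
      (∀ M ∈ x.support, Reducible a M → M.rank < k) →
        ReflTransGen (Rewrites a) x (normalize a x) := by
    intro k
    induction k with
    | zero =>
      intro x hx
      rw [normalize_eq_self fun M hM hr => absurd (hx M hM hr) (Nat.not_lt_zero _)]
    | succ k ih =>
      intro x
      induction hc : (x.support.filter fun M => Reducible a M ∧ M.rank = k).card using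
        Nat.strong_induction_on generalizing x with | _ c ihc =>
      intro hx
      by_cases hex : ∃ M ∈ x.support, Reducible a M ∧ M.rank = k
      · obtain ⟨M, hM, hred, hrank⟩ := hex
        obtain ⟨r, h₁, h₂⟩ := exists_rule_normalForm hred
        have hstep : Rewrites a x (x M • r + x.erase M) :=
          ⟨M, r, x M, x.erase M, h₁, Finsupp.mem_support_iff.1 hM, by simp,
            (Finsupp.single_add_erase M x).symm, rfl⟩
        -- The step uses the very rule chosen by `normalForm`, so it preserves the normal form
        -- without any confluence assumption.
        have hnorm : normalize a (x M • r + x.erase M) = normalize a x := by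
          conv_rhs => rw [← Finsupp.single_add_erase M x]
          rw [map_add, map_add, map_smul, normalize_single, h₂]
        have hsupp : ∀ M' ∈ (x M • r + x.erase M).support,
            M'.rank < k ∨ (M' ∈ x.support ∧ M' ≠ M) := by
          intro M' hM'
          rcases Finset.mem_union.1 (Finsupp.support_add hM') with h | h
          · exact .inl (hrank ▸ h₁.rank_lt (Finsupp.support_smul h))
          · rw [Finsupp.support_erase, Finset.mem_erase] at h
            exact .inr ⟨h.2, h.1⟩
        refine .head hstep (hnorm ▸ ihc _ ?_ _ rfl ?_)
        · rw [← hc]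
          refine Finset.card_lt_card (Finset.ssubset_iff_of_subset ?_ |>.2 ⟨M, ?_, ?_⟩)
          · intro M' h
            rw [Finset.mem_filter] at h ⊢
            rcases hsupp M' h.1 with h' | h'
            · exact absurd h.2.2 h'.ne
            · exact ⟨h'.1, h.2⟩
          · exact Finset.mem_filter.2 ⟨hM, hred, hrank⟩
          · intro h
            rw [Finset.mem_filter] at h
            rcases hsupp M h.1 with h' | h'
            · exact absurd hrank h'.ne
            · exact h'.2 rfl
        · intro M' h hr
          rcases hsupp M' h with h' | h'
          · exact h'.trans (Nat.lt_succ_self k)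
          · exact hx M' h'.1 hr
      · refine ih x fun M hM hr => lt_of_le_of_ne (Nat.lt_succ_iff.1 (hx M hM hr)) fun h => ?_
        exact hex ⟨M, hM, hr, h⟩
  exact key (∑ M ∈ x.support, M.rank + 1) x fun M hM _ =>
    Nat.lt_succ_of_le (Finset.single_le_sum (f := fun M : Monomial 3 m n => M.rank)
      (fun _ _ => Nat.zero_le _) hM)

theorem eq_of_rewrites_of_normal {a : Fin 4 → ℂ} {x y : FreeProperad 3 m n}
    (hx : ∀ M ∈ x.support, ¬ Reducible a M) (h : ReflTransGen (Rewrites a) x y) : y = x := by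
  rcases h.cases_head with h | ⟨z, ⟨M, r, c, u, hM, hc, hu, rfl, -⟩, -⟩
  · exact h.symm
  · refine absurd ⟨r, hM⟩ (hx M ?_)
    simp [Finsupp.notMem_support_iff.1 hu, hc]

/-- In a confluent system, both sides of a critical pair have the same normal form. -/
theorem normalize_eq_of_confluent {a : Fin 4 → ℂ}
    (h : Confluent (Rewrites a (k := 3) (m := m) (n := n))) {M : Monomial 3 m n}
    {r r' : FreeProperad 3 m n} (hr : MonomialRule a M r) (hr' : MonomialRule a M r') :
    normalize a r = normalize a r' := by
  have step : ∀ {r}, MonomialRule a M r →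
      ReflTransGen (Rewrites a) (Finsupp.single M 1) (normalize a r) := fun {r} hr =>
    .head ⟨M, r, 1, 0, hr, one_ne_zero, by simp, by simp, by simp⟩ (rewrites_normalize a r)
  obtain ⟨w, h₁, h₂⟩ := h _ _ _ (step hr) (step hr')
  rw [← eq_of_rewrites_of_normal (fun _ => not_reducible_of_mem_normalize) h₁,
    eq_of_rewrites_of_normal (fun _ => not_reducible_of_mem_normalize) h₂]

/-- A system is confluent when both sides of each critical pair have the same normal form. -/
theorem confluent_of_normalize_eq {a : Fin 4 → ℂ}
    (h : ∀ (M : Monomial 3 m n) (r r' : FreeProperad 3 m n), MonomialRule a M r →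
      MonomialRule a M r' → normalize a r = normalize a r') :
    Confluent (Rewrites a (k := 3) (m := m) (n := n)) := by
  -- Under the hypothesis the rule applied may be exchanged for the chosen one. The normal form is
  -- then invariant under rewriting, and serves as the common reduct.
  have step : ∀ {x y : FreeProperad 3 m n}, Rewrites a x y → normalize a y = normalize a x := by
    rintro x y ⟨M, r, c, u, hM, -, -, rfl, rfl⟩
    obtain ⟨r', h₁, h₂⟩ := exists_rule_normalForm ⟨r, hM⟩
    rw [map_add, map_add, map_smul, normalize_single, h₂, h _ _ _ hM h₁]
  have steps : ∀ {x y : FreeProperad 3 m n}, ReflTransGen (Rewrites a) x y →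
      normalize a y = normalize a x := by
    intro x y hxy
    induction hxy with
    | refl => rfl
    | tail _ h ih => rw [step h, ih]
  intro x y z hy hz
  refine ⟨normalize a x, ?_, ?_⟩
  · rw [← steps hy]; exact rewrites_normalize a y
  · rw [← steps hz]; exact rewrites_normalize a z

end NormalForm

/-! ### Graphs given by lists of wires, for decidable computations -/

/-- A graph of weight three, given by the list of its wires. -/
structure Code (m n : ℕ) where
  lab : Fin 3 → Gen
  wires : List (Source 3 n × Target 3 m)

namespace Code

variable {m n p q : ℕ}

/-- The number of vertices with a path to `v`. -/
def height (c : Code m n) (v : Fin 3) : ℕ :=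
  (Finset.univ.filter fun u => VertexLink (wiresOf c.wires) u v ∨
    ∃ w, VertexLink (wiresOf c.wires) u w ∧ VertexLink (wiresOf c.wires) w v).card

/-- The wires form a connected directed graph without oriented cycles. -/
def Valid (c : Code m n) : Prop :=
  (∀ s t, wiresOf c.wires s t → IsSource c.lab s ∧ IsTarget c.lab t) ∧
  (∀ s, IsSource c.lab s →
    ∃ t, wiresOf c.wires s t ∧ ∀ y, wiresOf c.wires s y → y = t) ∧
  (∀ t, IsTarget c.lab t →
    ∃ s, wiresOf c.wires s t ∧ ∀ y, wiresOf c.wires y t → y = s) ∧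
  -- Acyclicity in decidable form. With three vertices, paths of at most two links suffice to define
  -- `height`.
  (∀ v w, VertexLink (wiresOf c.wires) v w → c.height v < c.height w) ∧
  ∃ v : Fin 3, ∀ x : Node 3 m n, x = Sum.inl v ∨
    (NodeLink (wiresOf c.wires) x (Sum.inl v) ∨ NodeLink (wiresOf c.wires) (Sum.inl v) x) ∨
    ∃ y, (NodeLink (wiresOf c.wires) x y ∨ NodeLink (wiresOf c.wires) y x) ∧
      (NodeLink (wiresOf c.wires) y (Sum.inl v) ∨ NodeLink (wiresOf c.wires) (Sum.inl v) y)

instance (c : Code m n) : Decidable c.Valid := by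
  unfold Valid
  refine @instDecidableAnd _ _ ?_ (@instDecidableAnd _ _ ?_ (@instDecidableAnd _ _ ?_
    (@instDecidableAnd _ _ ?_ ?_)))
  all_goals infer_instance

/-- The graph of a valid code. -/
def graph (c : Code m n) (h : c.Valid) : Graph 3 m n where
  lab := c.lab
  wire := wiresOf c.wires
  wire_valid := h.1
  source_unique := existsUnique_of h.2.1
  target_unique := existsUnique_of (r := fun t s => wiresOf c.wires s t) h.2.2.1
  acyclic := acyclic_of_rank c.height h.2.2.2.1
  nonempty := ⟨Sum.inl 0⟩
  connected := connected_of_root (Sum.inl h.2.2.2.2.choose) h.2.2.2.2.choose_spec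

/-- The ports of two vertices. -/
def ports : List (Fin 2 × Fin 2) := [(0, 0), (0, 1), (1, 0), (1, 1)]

theorem mem_ports (x : Fin 2 × Fin 2) : x ∈ ports := by
  revert x; decide

/-- The ports of the other vertices. -/
def outerPorts (u v : Fin 3) : List (Fin 3 × Fin 2) :=
  [(0, 0), (0, 1), (1, 0), (1, 1), (2, 0), (2, 1)].filter fun x => x.1 ≠ u ∧ x.1 ≠ v

/-- The port of the vertex `u` or `v` that corresponds to a port of the vertex `0` or `1`. -/
def place (u v : Fin 3) (x : Fin 2 × Fin 2) : Fin 3 × Fin 2 := (![u, v] x.1, x.2)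

variable (H H' : Graph 2 p q) [∀ s t, Decidable (H.wire s t)] [∀ s t, Decidable (H'.wire s t)]

/-- The corresponding outputs of `H` and `H'`. -/
def outputPairs : List ((Fin 2 × Fin 2) × (Fin 2 × Fin 2)) :=
  (ports ×ˢ ports).filter fun x =>
    ∃ j, H.wire (Sum.inl x.1) (Sum.inr j) ∧ H'.wire (Sum.inl x.2) (Sum.inr j)

/-- The corresponding inputs of `H` and `H'`. -/
def inputPairs : List ((Fin 2 × Fin 2) × (Fin 2 × Fin 2)) :=
  (ports ×ˢ ports).filter fun x =>
    ∃ i, H.wire (Sum.inr i) (Sum.inl x.1) ∧ H'.wire (Sum.inr i) (Sum.inl x.2)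

/-- The sources that correspond to each other when `H` is replaced by `H'` at `u, v`. -/
def sourcePairs (n : ℕ) (u v : Fin 3) : List (Source 3 n × Source 3 n) :=
  ((List.finRange n).map fun i => (Sum.inr i, Sum.inr i)) ++
  ((outerPorts u v).map fun x => (Sum.inl x, Sum.inl x)) ++
  ((outputPairs H H').map fun x => (Sum.inl (place u v x.1), Sum.inl (place u v x.2)))

/-- The targets that correspond to each other when `H` is replaced by `H'` at `u, v`. -/
def targetPairs (m : ℕ) (u v : Fin 3) : List (Target 3 m × Target 3 m) :=
  ((List.finRange m).map fun i => (Sum.inr i, Sum.inr i)) ++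
  ((outerPorts u v).map fun x => (Sum.inl x, Sum.inl x)) ++
  ((inputPairs H H').map fun x => (Sum.inl (place u v x.1), Sum.inl (place u v x.2)))

/-- The replacement of `H` by `H'` at the vertices `u, v`. -/
def step (c : Code m n) (u v : Fin 3) : Code m n where
  lab := c.lab
  wires :=
    ((ports ×ˢ ports).filter fun x => H'.wire (Sum.inl x.1) (Sum.inl x.2)).map
      (fun x => (Sum.inl (place u v x.1), Sum.inl (place u v x.2))) ++
    -- The other wires are transported end by end. The inner wire of `H` disappears by itself: its
    -- ends correspond to no output and no input of `H`, so the product of lists is empty.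
    c.wires.flatMap fun w =>
      ((sourcePairs H H' n u v).filter fun s => s.1 = w.1).map Prod.snd ×ˢ
        ((targetPairs H H' m u v).filter fun t => t.1 = w.2).map Prod.snd

/-- The vertices `u, v` carry `H`, and `step` replaces it by `H'`. -/
def CanReplace (c : Code m n) (u v : Fin 3) : Prop :=
  H'.lab = H.lab ∧ (∀ w, c.lab (![u, v] w) = H.lab w) ∧
  (∀ x y, H.wire (Sum.inl x) (Sum.inl y) →
    wiresOf c.wires (Sum.inl (place u v x)) (Sum.inl (place u v y))) ∧
  (∀ x y, H'.wire (Sum.inl x) (Sum.inl y) →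
    wiresOf (c.step H H' u v).wires (Sum.inl (place u v x)) (Sum.inl (place u v y))) ∧
  ∀ s ∈ sourcePairs H H' n u v, ∀ t ∈ targetPairs H H' m u v,
    (wiresOf c.wires s.1 t.1 ↔ wiresOf (c.step H H' u v).wires s.2 t.2)

instance (c : Code m n) (u v : Fin 3) : Decidable (c.CanReplace H H' u v) := by
  unfold CanReplace
  infer_instance

end Code

/-- The embedding with values `u, v`. -/
def pairEmb (u v : Fin 3) (h : u ≠ v) : Fin 2 ↪ Fin 3 :=
  ⟨![u, v], by intro i j; fin_cases i <;> fin_cases j <;> simp [h, h.symm]⟩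

theorem mem_outerPorts {u v : Fin 3} {h : u ≠ v} {w : Fin 3} (hw : w ∉ Set.range (pairEmb u v h))
    (i : Fin 2) : (w, i) ∈ Code.outerPorts u v := by
  have h₁ : w ≠ u := fun e => hw ⟨0, e.symm⟩
  have h₂ : w ≠ v := fun e => hw ⟨1, e.symm⟩
  have : ∀ x : Fin 3 × Fin 2, x ∈ [((0 : Fin 3), (0 : Fin 2)), (0, 1), (1, 0), (1, 1), (2, 0),
    (2, 1)] := by decide
  exact List.mem_filter.2 ⟨this _, by simpa using ⟨h₁, h₂⟩⟩

namespace Code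

variable {m n p q : ℕ}

/-- The lists `sourcePairs` and `targetPairs` exhaust the corresponding ports, so the finite check
implies the condition on all of them. -/
theorem CanReplace.replace {H H' : Graph 2 p q} [∀ s t, Decidable (H.wire s t)]
    [∀ s t, Decidable (H'.wire s t)] {c : Code m n} {u v : Fin 3} (h : c.CanReplace H H' u v)
    (huv : u ≠ v) (hc : c.Valid) (hc' : (c.step H H' u v).Valid) :
    Replace H H' (pairEmb u v huv) (c.graph hc) ((c.step H H' u v).graph hc') where
  occurs := ⟨h.2.1, h.2.2.1⟩
  occurs' := ⟨fun w => by rw [h.1]; exact h.2.1 w, h.2.2.2.1⟩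
  lab_outer _ _ := rfl
  outer s s' t t' hs ht := by
    have hs' : (s, s') ∈ sourcePairs H H' n u v := by
      simp only [sourcePairs, List.mem_append, List.mem_map]
      rcases hs with ⟨i, rfl, rfl⟩ | ⟨w, i, hw, rfl, rfl⟩ | ⟨j, x, x', h₁, h₂, rfl, rfl⟩
      · exact .inl (.inl ⟨i, List.mem_finRange i, rfl⟩)
      · exact .inl (.inr ⟨(w, i), mem_outerPorts hw i, rfl⟩)
      · exact .inr ⟨(x, x'), List.mem_filter.2 ⟨List.mem_product.2 ⟨mem_ports _, mem_ports _⟩,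
          by simpa using ⟨j, h₁, h₂⟩⟩, rfl⟩
    have ht' : (t, t') ∈ targetPairs H H' m u v := by
      simp only [targetPairs, List.mem_append, List.mem_map]
      rcases ht with ⟨i, rfl, rfl⟩ | ⟨w, i, hw, rfl, rfl⟩ | ⟨j, x, x', h₁, h₂, rfl, rfl⟩
      · exact .inl (.inl ⟨i, List.mem_finRange i, rfl⟩)
      · exact .inl (.inr ⟨(w, i), mem_outerPorts hw i, rfl⟩)
      · exact .inr ⟨(x, x'), List.mem_filter.2 ⟨List.mem_product.2 ⟨mem_ports _, mem_ports _⟩,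
          by simpa using ⟨j, h₁, h₂⟩⟩, rfl⟩
    exact h.2.2.2.2 _ hs' _ ht'

/-- The vertices `u, v` carry the left-hand side of a rule. -/
def Redex (c : Code m n) (u v : Fin 3) : Prop :=
  wiresOf c.wires (Sum.inl (u, 0)) (Sum.inl (v, 0)) ∧ ¬ (c.lab u = .coprod ∧ c.lab v = .prod)

/-- Only the vertices `u, v` carry the left-hand side of a rule. -/
def UniqueRedex (c : Code m n) (u v : Fin 3) : Prop := ∀ u' v', c.Redex u' v' → u' = u ∧ v' = v

/-- No rule applies. -/
def Normal (c : Code m n) : Prop := ∀ u v, ¬ c.Redex u v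

/-- The codes define isomorphic graphs. -/
def Iso (c c' : Code m n) : Prop :=
  ∃ σ : Equiv.Perm (Fin 3), (∀ v, c'.lab (σ v) = c.lab v) ∧
    ∀ s t, wiresOf c'.wires (Sum.map (mapPort σ) id s) (Sum.map (mapPort σ) id t) ↔
      wiresOf c.wires s t

instance (c : Code m n) (u v : Fin 3) : Decidable (c.Redex u v) := by unfold Redex; infer_instance
instance (c : Code m n) (u v : Fin 3) : Decidable (c.UniqueRedex u v) := by
  unfold UniqueRedex; infer_instance
instance (c : Code m n) : Decidable c.Normal := by unfold Normal; infer_instance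
instance (c c' : Code m n) : Decidable (c.Iso c') := by unfold Iso; infer_instance

variable {m' n' : ℕ}

open Classical in
/-- The normal form of the monomial of a code, with renumbered global inputs and outputs. -/
noncomputable def nf (a : Fin 4 → ℂ) (α : Fin n ≃ Fin n') (β : Fin m ≃ Fin m') (c : Code m n) :
    FreeProperad 3 m' n' :=
  if h : c.Valid then
    normalForm a (Quotient.mk _ ((c.graph h).relabel (Equiv.refl _) α β))
  else 0

variable (a : Fin 4 → ℂ) (α : Fin n ≃ Fin n') (β : Fin m ≃ Fin m')

theorem normalize_toFree {c : Code m n} (h : c.Valid) :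
    normalize a ((c.graph h).relabel (Equiv.refl _) α β).toFree = c.nf a α β := by
  rw [nf, dif_pos h, Graph.toFree, normalize_single, one_smul]

theorem nf_congr {c c' : Code m n} (h : c.Valid ∧ c'.Valid ∧ c.Iso c') :
    c.nf a α β = c'.nf a α β := by
  obtain ⟨h₁, h₂, h₃⟩ := h
  rw [nf, nf, dif_pos h₁, dif_pos h₂,
    Graph.mk_relabel_congr (G := c.graph h₁) (G' := c'.graph h₂) h₃]

theorem Normal.not_reducible {c : Code m n} (h : c.Normal) (hc : c.Valid) :
    ¬ Reducible a (Quotient.mk _ (c.graph hc)) := by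
  rintro ⟨r, hr⟩
  obtain ⟨f, hf⟩ := monomialRule_mk.1 hr
  exact h _ _ hf.redex

theorem nf_of_normal {c : Code m n} (h : c.Normal) (hc : c.Valid) :
    c.nf a (Equiv.refl _) (Equiv.refl _) = (c.graph hc).toFree := by
  rw [nf, dif_pos hc, Graph.relabel_refl, normalForm_of_not_reducible (h.not_reducible a hc)]
  rfl

/-- `H` can be replaced by `H'` at the vertices `u, v`, with valid results. -/
def Applies (H H' : Graph 2 p q) [∀ s t, Decidable (H.wire s t)]
    [∀ s t, Decidable (H'.wire s t)] (c : Code m n) (u v : Fin 3) : Prop :=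
  u ≠ v ∧ c.Valid ∧ (c.step H H' u v).Valid ∧ c.CanReplace H H' u v

instance (H H' : Graph 2 p q) [∀ s t, Decidable (H.wire s t)]
    [∀ s t, Decidable (H'.wire s t)] (c : Code m n) (u v : Fin 3) :
    Decidable (c.Applies H H' u v) := by
  unfold Applies; infer_instance

theorem Applies.replace {H H' : Graph 2 p q} [∀ s t, Decidable (H.wire s t)]
    [∀ s t, Decidable (H'.wire s t)] {c : Code m n} {u v : Fin 3} (h : c.Applies H H' u v)
    (α : Fin n ≃ Fin n') (β : Fin m ≃ Fin m') :
    Replace H H' (pairEmb u v h.1) ((c.graph h.2.1).relabel (Equiv.refl _) α β)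
      (((c.step H H' u v).graph h.2.2.1).relabel (Equiv.refl _) α β) :=
  (h.2.2.2.replace h.1 h.2.1 h.2.2.1).relabel (Equiv.refl _) α β

/-- The rule at the vertices `u, v` rewrites the graph of `c`, with renumbered global inputs and
outputs, to an element with normal form `y`. -/
def ReducesTo (c : Code m n) (u v : Fin 3) (y : FreeProperad 3 m' n') : Prop :=
  ∃ (huv : u ≠ v) (hc : c.Valid) (r : FreeProperad 3 m' n'),
    RuleAt a (pairEmb u v huv) ((c.graph hc).relabel (Equiv.refl _) α β) r ∧ normalize a r = y

theorem reducesTo_assoc {c : Code m n} {u v : Fin 3} (h : c.Applies leftComb rightComb u v) :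
    c.ReducesTo a α β u v ((c.step leftComb rightComb u v).nf a α β) :=
  ⟨h.1, h.2.1, _, .assoc _ (h.replace α β), normalize_toFree a α β h.2.2.1⟩

theorem reducesTo_coassoc {c : Code m n} {u v : Fin 3}
    (h : c.Applies leftCocomb rightCocomb u v) :
    c.ReducesTo a α β u v ((c.step leftCocomb rightCocomb u v).nf a α β) :=
  ⟨h.1, h.2.1, _, .coassoc _ (h.replace α β), normalize_toFree a α β h.2.2.1⟩

theorem reducesTo_between {c : Code m n} {u v : Fin 3}
    (h : c.Applies coprodOfProd term₁ u v ∧ c.Applies coprodOfProd term₂ u v ∧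
      c.Applies coprodOfProd term₃ u v ∧ c.Applies coprodOfProd term₄ u v) :
    c.ReducesTo a α β u v
      (a 0 • (c.step coprodOfProd term₁ u v).nf a α β +
        a 1 • (c.step coprodOfProd term₂ u v).nf a α β +
        a 2 • (c.step coprodOfProd term₃ u v).nf a α β +
        a 3 • (c.step coprodOfProd term₄ u v).nf a α β) := by
  obtain ⟨h₁, h₂, h₃, h₄⟩ := h
  refine ⟨h₁.1, h₁.2.1, _, .between _ _ _ _ (h₁.replace α β) (h₂.replace α β) (h₃.replace α β)
    (h₄.replace α β), ?_⟩
  simp only [map_add, map_smul, normalize_toFree]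

variable {a α β}

theorem pairEmb_eq {u v : Fin 3} (h : u ≠ v) {f : Fin 2 ↪ Fin 3} (h₀ : f 0 = u) (h₁ : f 1 = v) :
    f = pairEmb u v h := by
  ext i
  fin_cases i
  · exact congrArg Fin.val h₀
  · exact congrArg Fin.val h₁

/-- `normalForm` rests on an arbitrary choice of rules. Where only one position admits a rule the
choice is forced, and the normal form can be computed. -/
theorem ReducesTo.nf_eq {c : Code m n} {u v : Fin 3} {y : FreeProperad 3 m' n'}
    (h : c.ReducesTo a α β u v y) (hu : c.UniqueRedex u v) : c.nf a α β = y := by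
  obtain ⟨huv, hc, r, hr, rfl⟩ := h
  rw [nf, dif_pos hc]
  refine normalForm_of_unique hr.monomialRule fun r' hr' => ?_
  obtain ⟨f, hf⟩ := monomialRule_mk.1 hr'
  have hred : c.Redex (f 0) (f 1) := by
    refine ⟨?_, hf.redex.2⟩
    exact hf.redex.1
  obtain ⟨h₀, h₁⟩ := hu _ _ hred
  rw [pairEmb_eq huv h₀ h₁] at hf
  exact hf.unique hr

end Code

/-! ### The four critical monomials, and the pentagon with its dual -/

namespace Code

variable {m n m' n' : ℕ}

/-- `((x y) z) w` -/
def prod₃ : Code 1 4 where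
  lab := ![.prod, .prod, .prod]
  wires := [(leg 0, port 0 0), (leg 1, port 0 1), (port 0 0, port 1 0), (leg 2, port 1 1),
    (port 1 0, port 2 0), (leg 3, port 2 1), (port 2 0, leg 0)]

/-- `(Δ ⊗ id ⊗ id) (Δ ⊗ id) Δ` -/
def coprod₃ : Code 4 1 where
  lab := ![.coprod, .coprod, .coprod]
  wires := [(leg 0, port 0 0), (port 0 0, port 1 0), (port 0 1, leg 3), (port 1 0, port 2 0),
    (port 1 1, leg 2), (port 2 0, leg 0), (port 2 1, leg 1)]

/-- `Δ ((x y) z)` -/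
def prod₂coprod : Code 2 3 where
  lab := ![.prod, .prod, .coprod]
  wires := [(leg 0, port 0 0), (leg 1, port 0 1), (port 0 0, port 1 0), (leg 2, port 1 1),
    (port 1 0, port 2 0), (port 2 0, leg 0), (port 2 1, leg 1)]

/-- `(Δ ⊗ id) Δ (x y)` -/
def prodCoprod₂ : Code 3 2 where
  lab := ![.prod, .coprod, .coprod]
  wires := [(leg 0, port 0 0), (leg 1, port 0 1), (port 0 0, port 1 0), (port 1 0, port 2 0),
    (port 1 1, leg 2), (port 2 0, leg 0), (port 2 1, leg 1)]

/-- The effect of associativity. -/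
abbrev assoc (c : Code m n) (u v : Fin 3) : Code m n := c.step leftComb rightComb u v

/-- The effect of coassociativity. -/
abbrev coassoc (c : Code m n) (u v : Fin 3) : Code m n := c.step leftCocomb rightCocomb u v

/-- The first term of the third rule. -/
abbrev move₁ (c : Code m n) (u v : Fin 3) : Code m n := c.step coprodOfProd term₁ u v

/-- The second term of the third rule. -/
abbrev move₂ (c : Code m n) (u v : Fin 3) : Code m n := c.step coprodOfProd term₂ u v

/-- The third term of the third rule. -/
abbrev move₃ (c : Code m n) (u v : Fin 3) : Code m n := c.step coprodOfProd term₃ u v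

/-- The fourth term of the third rule. -/
abbrev move₄ (c : Code m n) (u v : Fin 3) : Code m n := c.step coprodOfProd term₄ u v

variable {a : Fin 4 → ℂ} {α : Fin n ≃ Fin n'} {β : Fin m ≃ Fin m'}

theorem nf_assoc {c : Code m n} (u v : Fin 3)
    (h : c.Applies leftComb rightComb u v ∧ c.UniqueRedex u v) :
    c.nf a α β = (c.assoc u v).nf a α β :=
  (reducesTo_assoc a α β h.1).nf_eq h.2

theorem nf_coassoc {c : Code m n} (u v : Fin 3)
    (h : c.Applies leftCocomb rightCocomb u v ∧ c.UniqueRedex u v) :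
    c.nf a α β = (c.coassoc u v).nf a α β :=
  (reducesTo_coassoc a α β h.1).nf_eq h.2

theorem nf_between {c : Code m n} (u v : Fin 3)
    (h : (c.Applies coprodOfProd term₁ u v ∧ c.Applies coprodOfProd term₂ u v ∧
      c.Applies coprodOfProd term₃ u v ∧ c.Applies coprodOfProd term₄ u v) ∧
      c.UniqueRedex u v) :
    c.nf a α β = a 0 • (c.move₁ u v).nf a α β + a 1 • (c.move₂ u v).nf a α β +
      a 2 • (c.move₃ u v).nf a α β + a 3 • (c.move₄ u v).nf a α β :=
  (reducesTo_between a α β h.1).nf_eq h.2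

/-- Both ways to rewrite `((x y) z) w` lead to the same normal form. -/
theorem nf_prod₃ {α : Fin 4 ≃ Fin n'} {β : Fin 1 ≃ Fin m'} :
    (prod₃.assoc 0 1).nf a α β = (prod₃.assoc 1 2).nf a α β := by
  -- The pentagon: two further steps on one side, one on the other.
  rw [nf_assoc (c := prod₃.assoc 0 1) 1 2 (by decide +kernel),
    nf_assoc (c := (prod₃.assoc 0 1).assoc 1 2) 0 1 (by decide +kernel),
    nf_assoc (c := prod₃.assoc 1 2) 0 2 (by decide +kernel)]
  exact nf_congr a α β (by decide +kernel)

/-- Both ways to rewrite `(Δ ⊗ id ⊗ id) (Δ ⊗ id) Δ` lead to the same normal form. -/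
theorem nf_coprod₃ {α : Fin 1 ≃ Fin n'} {β : Fin 4 ≃ Fin m'} :
    (coprod₃.coassoc 0 1).nf a α β = (coprod₃.coassoc 1 2).nf a α β := by
  -- The pentagon upside down: here the shorter branch is the one starting at the vertices `0, 1`.
  rw [nf_coassoc (c := coprod₃.coassoc 0 1) 0 2 (by decide +kernel),
    nf_coassoc (c := coprod₃.coassoc 1 2) 0 1 (by decide +kernel),
    nf_coassoc (c := (coprod₃.coassoc 1 2).coassoc 0 1) 1 2 (by decide +kernel)]
  exact nf_congr a α β (by decide +kernel)

end Code

/-! ### The two mixed critical pairs -/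

namespace Code

variable {m' n' : ℕ} {a : Fin 4 → ℂ}

/-- The normal monomials that tell the two ways to rewrite `Δ ((x y) z)` apart. -/
def prod₂coprodNormal : Fin 8 → Code 2 3 :=
  ![(prod₂coprod.assoc 0 1).move₁ 1 2, ((prod₂coprod.assoc 0 1).move₂ 1 2).move₂ 0 2,
    (prod₂coprod.assoc 0 1).move₃ 1 2, ((prod₂coprod.assoc 0 1).move₄ 1 2).move₄ 0 2,
    ((prod₂coprod.assoc 0 1).move₂ 1 2).move₄ 0 2, ((prod₂coprod.assoc 0 1).move₄ 1 2).move₂ 0 2,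
    (prod₂coprod.move₁ 1 2).move₃ 0 2, (prod₂coprod.move₃ 1 2).move₁ 0 2]

/-- Their coefficients. -/
def prod₂coprodCoeff (a : Fin 4 → ℂ) : Fin 8 → ℂ :=
  ![a 0 - a 0 ^ 2, a 1 ^ 2 - a 1, a 2 - a 2 ^ 2, a 3 ^ 2 - a 3, a 1 * a 3, a 1 * a 3,
    -(a 0 * a 2), -(a 0 * a 2)]

-- Both sides expand by the third rule. Terms such as `x y' ⊗ y'' z` occur on both sides with the
-- same coefficient and cancel. Four monomials occur with `aᵢ` on one side and `aᵢ²` on the other.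
-- The terms with `a₂a₄` arise only from `Δ (x (y z))`, and those with `a₁a₃` only from the other
-- branch.
set_option maxHeartbeats 2000000 in
theorem nf_prod₂coprod {α : Fin 3 ≃ Fin n'} {β : Fin 2 ≃ Fin m'} :
    (prod₂coprod.assoc 0 1).nf a α β =
      (a 0 • (prod₂coprod.move₁ 1 2).nf a α β + a 1 • (prod₂coprod.move₂ 1 2).nf a α β +
        a 2 • (prod₂coprod.move₃ 1 2).nf a α β + a 3 • (prod₂coprod.move₄ 1 2).nf a α β) +
      ∑ i, prod₂coprodCoeff a i • (prod₂coprodNormal i).nf a α β := by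
  -- `h₁` to `h₃` expand the branch through associativity, `h₄` and `h₅` the other one. The
  -- remaining equations bring the monomials common to both branches to the same representative,
  -- often after a last use of associativity.
  have h₁ : (prod₂coprod.assoc 0 1).nf a α β = _ := nf_between 1 2 (by decide +kernel)
  have h₂ : ((prod₂coprod.assoc 0 1).move₂ 1 2).nf a α β = _ := nf_between 0 2 (by decide +kernel)
  have h₃ : ((prod₂coprod.assoc 0 1).move₄ 1 2).nf a α β = _ := nf_between 0 2 (by decide +kernel)
  have h₄ : (prod₂coprod.move₁ 1 2).nf a α β = _ := nf_between 0 2 (by decide +kernel)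
  have h₅ : (prod₂coprod.move₃ 1 2).nf a α β = _ := nf_between 0 2 (by decide +kernel)
  have h₆ : ((prod₂coprod.move₁ 1 2).move₁ 0 2).nf a α β =
      ((prod₂coprod.assoc 0 1).move₁ 1 2).nf a α β :=
    (nf_assoc 0 1 (by decide +kernel)).trans (nf_congr a α β (by decide +kernel))
  have h₇ : ((prod₂coprod.move₁ 1 2).move₂ 0 2).nf a α β =
      (((prod₂coprod.assoc 0 1).move₂ 1 2).move₁ 0 2).nf a α β :=
    nf_congr a α β (by decide +kernel)
  have h₈ : ((prod₂coprod.move₁ 1 2).move₄ 0 2).nf a α β =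
      (((prod₂coprod.assoc 0 1).move₄ 1 2).move₁ 0 2).nf a α β :=
    (nf_assoc 0 1 (by decide +kernel)).trans (nf_congr a α β (by decide +kernel))
  have h₉ : (prod₂coprod.move₂ 1 2).nf a α β =
      (((prod₂coprod.assoc 0 1).move₂ 1 2).move₂ 0 2).nf a α β :=
    (nf_assoc 0 1 (by decide +kernel)).trans (nf_congr a α β (by decide +kernel))
  have h₁₀ : ((prod₂coprod.move₃ 1 2).move₂ 0 2).nf a α β =
      (((prod₂coprod.assoc 0 1).move₂ 1 2).move₃ 0 2).nf a α β :=
    (nf_assoc 0 1 (by decide +kernel)).trans (nf_congr a α β (by decide +kernel))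
  have h₁₁ : ((prod₂coprod.move₃ 1 2).move₃ 0 2).nf a α β =
      ((prod₂coprod.assoc 0 1).move₃ 1 2).nf a α β :=
    (nf_assoc 0 1 (by decide +kernel)).trans (nf_congr a α β (by decide +kernel))
  have h₁₂ : ((prod₂coprod.move₃ 1 2).move₄ 0 2).nf a α β =
      (((prod₂coprod.assoc 0 1).move₄ 1 2).move₃ 0 2).nf a α β :=
    nf_congr a α β (by decide +kernel)
  have h₁₃ : (prod₂coprod.move₄ 1 2).nf a α β =
      (((prod₂coprod.assoc 0 1).move₄ 1 2).move₄ 0 2).nf a α β :=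
    (nf_assoc 0 1 (by decide +kernel)).trans (nf_congr a α β (by decide +kernel))
  rw [h₁, h₂, h₃, h₄, h₅, h₆, h₇, h₈, h₉, h₁₀, h₁₁, h₁₂, h₁₃]
  simp only [Fin.sum_univ_eight, prod₂coprodCoeff, prod₂coprodNormal, Matrix.cons_val]
  module

/-- The normal monomials that tell the two ways to rewrite `(Δ ⊗ id) Δ (x y)` apart. -/
def prodCoprod₂Normal : Fin 8 → Code 3 2 :=
  ![((prodCoprod₂.coassoc 1 2).move₁ 0 1).move₁ 0 2, (prodCoprod₂.coassoc 1 2).move₂ 0 1,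
    (prodCoprod₂.coassoc 1 2).move₃ 0 1, ((prodCoprod₂.coassoc 1 2).move₄ 0 1).move₄ 0 2,
    ((prodCoprod₂.coassoc 1 2).move₁ 0 1).move₄ 0 2,
    ((prodCoprod₂.coassoc 1 2).move₄ 0 1).move₁ 0 2,
    (prodCoprod₂.move₂ 0 1).move₃ 0 2, (prodCoprod₂.move₃ 0 1).move₂ 0 2]

/-- Their coefficients. -/
def prodCoprod₂Coeff (a : Fin 4 → ℂ) : Fin 8 → ℂ :=
  ![a 0 ^ 2 - a 0, a 1 - a 1 ^ 2, a 2 - a 2 ^ 2, a 3 ^ 2 - a 3, a 0 * a 3, a 0 * a 3,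
    -(a 1 * a 2), -(a 1 * a 2)]

-- The computation of `nf_prod₂coprod` turned upside down: coassociativity replaces associativity,
-- and the first two terms of the third rule trade places. The obstructing products are now `a₁a₄`
-- and `a₂a₃`.
set_option maxHeartbeats 2000000 in
theorem nf_prodCoprod₂ {α : Fin 2 ≃ Fin n'} {β : Fin 3 ≃ Fin m'} :
    (prodCoprod₂.coassoc 1 2).nf a α β =
      (a 0 • (prodCoprod₂.move₁ 0 1).nf a α β + a 1 • (prodCoprod₂.move₂ 0 1).nf a α β +
        a 2 • (prodCoprod₂.move₃ 0 1).nf a α β + a 3 • (prodCoprod₂.move₄ 0 1).nf a α β) +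
      ∑ i, prodCoprod₂Coeff a i • (prodCoprod₂Normal i).nf a α β := by
  have h₁ : (prodCoprod₂.coassoc 1 2).nf a α β = _ := nf_between 0 1 (by decide +kernel)
  have h₂ : ((prodCoprod₂.coassoc 1 2).move₁ 0 1).nf a α β = _ :=
    nf_between 0 2 (by decide +kernel)
  have h₃ : ((prodCoprod₂.coassoc 1 2).move₄ 0 1).nf a α β = _ :=
    nf_between 0 2 (by decide +kernel)
  have h₄ : (prodCoprod₂.move₂ 0 1).nf a α β = _ := nf_between 0 2 (by decide +kernel)
  have h₅ : (prodCoprod₂.move₃ 0 1).nf a α β = _ := nf_between 0 2 (by decide +kernel)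
  have h₆ : (prodCoprod₂.move₁ 0 1).nf a α β =
      (((prodCoprod₂.coassoc 1 2).move₁ 0 1).move₁ 0 2).nf a α β :=
    (nf_coassoc 1 2 (by decide +kernel)).trans (nf_congr a α β (by decide +kernel))
  have h₇ : ((prodCoprod₂.move₂ 0 1).move₁ 0 2).nf a α β =
      (((prodCoprod₂.coassoc 1 2).move₁ 0 1).move₂ 0 2).nf a α β :=
    nf_congr a α β (by decide +kernel)
  have h₈ : ((prodCoprod₂.move₂ 0 1).move₂ 0 2).nf a α β =
      ((prodCoprod₂.coassoc 1 2).move₂ 0 1).nf a α β :=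
    (nf_coassoc 1 2 (by decide +kernel)).trans (nf_congr a α β (by decide +kernel))
  have h₉ : ((prodCoprod₂.move₂ 0 1).move₄ 0 2).nf a α β =
      (((prodCoprod₂.coassoc 1 2).move₄ 0 1).move₂ 0 2).nf a α β :=
    (nf_coassoc 1 2 (by decide +kernel)).trans (nf_congr a α β (by decide +kernel))
  have h₁₀ : ((prodCoprod₂.move₃ 0 1).move₁ 0 2).nf a α β =
      (((prodCoprod₂.coassoc 1 2).move₁ 0 1).move₃ 0 2).nf a α β :=
    (nf_coassoc 1 2 (by decide +kernel)).trans (nf_congr a α β (by decide +kernel))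
  have h₁₁ : ((prodCoprod₂.move₃ 0 1).move₃ 0 2).nf a α β =
      ((prodCoprod₂.coassoc 1 2).move₃ 0 1).nf a α β :=
    (nf_coassoc 1 2 (by decide +kernel)).trans (nf_congr a α β (by decide +kernel))
  have h₁₂ : ((prodCoprod₂.move₃ 0 1).move₄ 0 2).nf a α β =
      (((prodCoprod₂.coassoc 1 2).move₄ 0 1).move₃ 0 2).nf a α β :=
    nf_congr a α β (by decide +kernel)
  have h₁₃ : (prodCoprod₂.move₄ 0 1).nf a α β =
      (((prodCoprod₂.coassoc 1 2).move₄ 0 1).move₄ 0 2).nf a α β :=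
    (nf_coassoc 1 2 (by decide +kernel)).trans (nf_congr a α β (by decide +kernel))
  rw [h₁, h₂, h₃, h₄, h₅, h₆, h₇, h₈, h₉, h₁₀, h₁₁, h₁₂, h₁₃]
  simp only [Fin.sum_univ_eight, prodCoprod₂Coeff, prodCoprod₂Normal, Matrix.cons_val]
  module

end Code

/-! ### Classification of overlapping left-hand sides -/

section Chain

variable {m n : ℕ}

/-- The vertices `0, 1, 2` form a chain, each pair of consecutive ones carrying the left-hand side
of a rule. -/
structure Graph.IsChain (G : Graph 3 m n) : Prop where
  first : G.Redex 0 1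
  second : G.Redex 1 2

/-- By acyclicity any other inner wire would go forward, and it could not leave from port `0`,
already used by the chain. It would leave from the second output of a coproduct; but along a chain
only coproducts follow a coproduct, and their single input is taken. -/
theorem Graph.IsChain.wire_iff {G : Graph 3 m n} (h : G.IsChain) (x y : Fin 3 × Fin 2) :
    G.wire (Sum.inl x) (Sum.inl y) ↔
      (x = (0, 0) ∧ y = (1, 0)) ∨ (x = (1, 0) ∧ y = (2, 0)) := by
  obtain ⟨⟨w₁, l₁⟩, ⟨w₂, l₂⟩⟩ := h
  have link₁ : VertexLink G.wire 0 1 := ⟨_, _, w₁⟩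
  have link₂ : VertexLink G.wire 1 2 := ⟨_, _, w₂⟩
  have input : ∀ v j, G.lab v = .coprod → IsTarget (m := m) G.lab (Sum.inl (v, j)) → j = 0 := by
    intro v j hv hj
    simp only [IsTarget, hv, Gen.numIn] at hj
    omega
  have output : ∀ v, IsSource (n := n) G.lab (Sum.inl (v, 1)) → G.lab v = .coprod := by
    intro v hv
    cases hl : G.lab v
    · simp [IsSource, hl, Gen.numOut] at hv
    · rfl
  have next : ∀ v, G.lab v = .coprod → v = 0 ∨ v = 1 → G.lab 1 = .coprod ∧ G.lab 2 = .coprod := by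
    rintro v hv (rfl | rfl) <;> revert hv l₁ l₂ <;>
      rcases G.lab 0 with _ | _ <;> rcases G.lab 1 with _ | _ <;> rcases G.lab 2 with _ | _ <;> simp
  constructor
  · intro hw
    obtain ⟨v, i⟩ := x
    obtain ⟨w, j⟩ := y
    have link : VertexLink G.wire v w := ⟨_, _, hw⟩
    have hi : i = 0 ∨ i = 1 := by omega
    have hvw : (v = 0 ∧ (w = 1 ∨ w = 2)) ∨ (v = 1 ∧ w = 2) := by
      have back : ∀ {v w}, Relation.ReflTransGen (VertexLink G.wire) w v →
          ¬ VertexLink G.wire v w := fun hr hl => G.acyclic _ (.head' hl hr)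
      fin_cases v <;> fin_cases w
      · exact absurd link (back .refl)
      · simp
      · simp
      · exact absurd link (back (.single link₁))
      · exact absurd link (back .refl)
      · simp
      · exact absurd link (back (.tail (.single link₁) link₂))
      · exact absurd link (back (.single link₂))
      · exact absurd link (back .refl)
    rcases hi with rfl | rfl
    · rcases hvw with ⟨rfl, -⟩ | ⟨rfl, -⟩
      · exact .inl ⟨rfl, (Sum.inl.inj (G.target_eq w₁ hw)).symm⟩
      · exact .inr ⟨rfl, (Sum.inl.inj (G.target_eq w₂ hw)).symm⟩
    · have hlab := next v (output v (G.wire_valid _ _ hw).1) (by tauto)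
      have hw' : w = 1 ∨ w = 2 := by tauto
      have hj : j = 0 := by
        refine input w j ?_ (G.wire_valid _ _ hw).2
        rcases hw' with rfl | rfl
        exacts [hlab.1, hlab.2]
      subst hj
      rcases hw' with rfl | rfl
      · simpa using congrArg Prod.snd (Sum.inl.inj (G.source_eq w₁ hw))
      · simpa using congrArg Prod.snd (Sum.inl.inj (G.source_eq w₂ hw))
  · rintro (⟨rfl, rfl⟩ | ⟨rfl, rfl⟩)
    exacts [w₁, w₂]

theorem Graph.IsChain.exists_relabel_eq {m' n' : ℕ} {G : Graph 3 m n} (h : G.IsChain)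
    {K : Graph 3 m' n'} (hK : K.IsChain) (hlab : G.lab = K.lab) :
    ∃ (α : Fin n' ≃ Fin n) (β : Fin m' ≃ Fin m), G = K.relabel (Equiv.refl _) α β :=
  K.exists_relabel_eq G 0 hlab.symm fun x y => by rw [h.wire_iff, hK.wire_iff]

/-- No coproduct precedes a product along a chain, so only four words of labels survive. For each of
them the inner wires are known, and only the numbering of the legs is free. -/
theorem Graph.IsChain.exists_code {G : Graph 3 m n} (h : G.IsChain) :
    (∃ hc α β, G = (Code.prod₃.graph hc).relabel (Equiv.refl _) α β) ∨
    (∃ hc α β, G = (Code.coprod₃.graph hc).relabel (Equiv.refl _) α β) ∨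
    (∃ hc α β, G = (Code.prod₂coprod.graph hc).relabel (Equiv.refl _) α β) ∨
    (∃ hc α β, G = (Code.prodCoprod₂.graph hc).relabel (Equiv.refl _) α β) := by
  have aux : ∀ {p q : ℕ} (c : Code p q), (c.Valid ∧ c.Redex 0 1 ∧ c.Redex 1 2) → G.lab = c.lab →
      ∃ hc α β, G = (c.graph hc).relabel (Equiv.refl _) α β := by
    rintro p q c ⟨hc, h₁, h₂⟩ hlab
    exact ⟨hc, h.exists_relabel_eq (K := c.graph hc) ⟨h₁, h₂⟩ hlab⟩
  have hlab : G.lab = ![G.lab 0, G.lab 1, G.lab 2] := by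
    ext v; fin_cases v <;> rfl
  have l₁ := h.first.2
  have l₂ := h.second.2
  revert l₁ l₂ hlab
  rcases G.lab 0 with _ | _ <;> rcases G.lab 1 with _ | _ <;> rcases G.lab 2 with _ | _ <;>
    intro hlab l₁ l₂ <;> simp at l₁ l₂
  · exact .inl (aux _ (by decide +kernel) hlab)
  · exact .inr (.inr (.inl (aux _ (by decide +kernel) hlab)))
  · exact .inr (.inr (.inr (aux _ (by decide +kernel) hlab)))
  · exact .inr (.inl (aux _ (by decide +kernel) hlab))

/-- A left-hand side is determined by its upper vertex, and also by its lower one, since a port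
carries one wire. Two of them share a vertex among three; unless they coincide, the lower vertex of
one is the upper vertex of the other. -/
theorem chain_or_eq {G : Graph 3 m n} {f g : Fin 2 ↪ Fin 3} (hf : G.Redex (f 0) (f 1))
    (hg : G.Redex (g 0) (g 1)) : f = g ∨ f 1 = g 0 ∨ g 1 = f 0 := by
  by_cases h₀ : f 0 = g 0
  · left
    have h₁ : f 1 = g 1 := by
      have := G.target_eq hf.1 (h₀ ▸ hg.1)
      exact congrArg Prod.fst (Sum.inl.inj this)
    ext i; fin_cases i
    exacts [congrArg Fin.val h₀, congrArg Fin.val h₁]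
  · by_cases h₁ : f 1 = g 1
    · exact absurd (congrArg Prod.fst (Sum.inl.inj (G.source_eq hf.1 (h₁ ▸ hg.1)))) h₀
    · right
      have e₁ : f 0 ≠ f 1 := f.injective.ne (by decide)
      have e₂ : g 0 ≠ g 1 := g.injective.ne (by decide)
      revert h₀ h₁ e₁ e₂
      generalize f 0 = a
      generalize f 1 = b
      generalize g 0 = c
      generalize g 1 = d
      revert a b c d
      decide

/-- Two different rules that apply to a graph apply, up to a renumbering of the vertices, along the
vertices of a chain. -/
theorem exists_chain_of_ruleAt {a : Fin 4 → ℂ} {G : Graph 3 m n} {f g : Fin 2 ↪ Fin 3}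
    {r r' : FreeProperad 3 m n} (hf : RuleAt a f G r) (hg : RuleAt a g G r') (hfg : f 1 = g 0) :
    ∃ G' : Graph 3 m n, G'.IsChain ∧ RuleAt a (pairEmb 0 1 (by decide)) G' r ∧
      RuleAt a (pairEmb 1 2 (by decide)) G' r' := by
  have e₁ : f 0 ≠ f 1 := f.injective.ne (by decide)
  have e₂ : g 0 ≠ g 1 := g.injective.ne (by decide)
  -- Otherwise the two wires would form an oriented cycle.
  have e₃ : f 0 ≠ g 1 := by
    intro e
    refine G.acyclic (f 0) (.tail (.single ⟨_, _, hf.redex.1⟩) ?_)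
    rw [hfg, e]
    exact ⟨_, _, hg.redex.1⟩
  obtain ⟨σ, h₀, h₁, h₂⟩ : ∃ σ : Equiv.Perm (Fin 3), σ (f 0) = 0 ∧ σ (f 1) = 1 ∧ σ (g 1) = 2 := by
    have key : ∀ u v w : Fin 3, u ≠ v → v ≠ w → u ≠ w →
        ∃ σ : Equiv.Perm (Fin 3), σ u = 0 ∧ σ v = 1 ∧ σ w = 2 := by decide
    exact key _ _ _ e₁ (hfg ▸ e₂) e₃
  have hf' := hf.relabel σ
  have hg' := hg.relabel σ
  rw [Code.pairEmb_eq (f := f.trans σ.toEmbedding) (u := 0) (v := 1) (by decide) h₀ h₁] at hf'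
  rw [Code.pairEmb_eq (f := g.trans σ.toEmbedding) (u := 1) (v := 2) (by decide)
    (by rw [← h₁, hfg]; rfl) h₂] at hg'
  exact ⟨_, ⟨hf'.redex, hg'.redex⟩, hf', hg'⟩

end Chain

/-! ### The criterion for confluence -/

section Criterion

variable {m n m' n' : ℕ} {a : Fin 4 → ℂ}

theorem Code.ReducesTo.normalize_eq {c : Code m n} {α : Fin n ≃ Fin n'} {β : Fin m ≃ Fin m'}
    {u v : Fin 3} {y : FreeProperad 3 m' n'} (h : c.ReducesTo a α β u v y) {huv : u ≠ v}
    {hc : c.Valid} {r : FreeProperad 3 m' n'}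
    (hr : RuleAt a (pairEmb u v huv) ((c.graph hc).relabel (Equiv.refl _) α β) r) :
    normalize a r = y := by
  obtain ⟨_, _, r', hr', rfl⟩ := h
  rw [hr.unique hr']

theorem reducesTo_prod₂coprod (a : Fin 4 → ℂ) (α : Fin 3 ≃ Fin n') (β : Fin 2 ≃ Fin m') :
    Code.prod₂coprod.ReducesTo a α β 0 1 ((Code.prod₂coprod.assoc 0 1).nf a α β) ∧
    Code.prod₂coprod.ReducesTo a α β 1 2
      (a 0 • (Code.prod₂coprod.move₁ 1 2).nf a α β + a 1 • (Code.prod₂coprod.move₂ 1 2).nf a α β +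
        a 2 • (Code.prod₂coprod.move₃ 1 2).nf a α β +
        a 3 • (Code.prod₂coprod.move₄ 1 2).nf a α β) :=
  ⟨Code.reducesTo_assoc a α β (by decide +kernel),
    Code.reducesTo_between a α β (by decide +kernel)⟩

theorem reducesTo_prodCoprod₂ (a : Fin 4 → ℂ) (α : Fin 2 ≃ Fin n') (β : Fin 3 ≃ Fin m') :
    Code.prodCoprod₂.ReducesTo a α β 1 2 ((Code.prodCoprod₂.coassoc 1 2).nf a α β) ∧
    Code.prodCoprod₂.ReducesTo a α β 0 1
      (a 0 • (Code.prodCoprod₂.move₁ 0 1).nf a α β + a 1 • (Code.prodCoprod₂.move₂ 0 1).nf a α β +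
        a 2 • (Code.prodCoprod₂.move₃ 0 1).nf a α β +
        a 3 • (Code.prodCoprod₂.move₄ 0 1).nf a α β) :=
  ⟨Code.reducesTo_coassoc a α β (by decide +kernel),
    Code.reducesTo_between a α β (by decide +kernel)⟩

/-- The four types of critical pair, one by one. Only the two mixed ones use the vanishing of the
coefficients. -/
theorem normalize_eq_of_isChain (h₁ : ∀ i, Code.prod₂coprodCoeff a i = 0)
    (h₂ : ∀ i, Code.prodCoprod₂Coeff a i = 0) {G : Graph 3 m n} (hG : G.IsChain)
    {r r' : FreeProperad 3 m n} (hr : RuleAt a (pairEmb 0 1 (by decide)) G r)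
    (hr' : RuleAt a (pairEmb 1 2 (by decide)) G r') : normalize a r = normalize a r' := by
  rcases hG.exists_code with ⟨hc, α, β, rfl⟩ | ⟨hc, α, β, rfl⟩ | ⟨hc, α, β, rfl⟩ | ⟨hc, α, β, rfl⟩
  · rw [(Code.reducesTo_assoc a α β (by decide +kernel)).normalize_eq hr,
      (Code.reducesTo_assoc a α β (by decide +kernel)).normalize_eq hr']
    exact Code.nf_prod₃
  · rw [(Code.reducesTo_coassoc a α β (by decide +kernel)).normalize_eq hr,
      (Code.reducesTo_coassoc a α β (by decide +kernel)).normalize_eq hr']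
    exact Code.nf_coprod₃
  · rw [(reducesTo_prod₂coprod a α β).1.normalize_eq hr,
      (reducesTo_prod₂coprod a α β).2.normalize_eq hr', Code.nf_prod₂coprod]
    simp [h₁]
  · rw [(reducesTo_prodCoprod₂ a α β).1.normalize_eq hr',
      (reducesTo_prodCoprod₂ a α β).2.normalize_eq hr, Code.nf_prodCoprod₂]
    simp [h₂]

/-- The coefficients that obstruct confluence are the only obstruction. -/
theorem inducesConfluentSystem_of_coeff_eq_zero (h₁ : ∀ i, Code.prod₂coprodCoeff a i = 0)
    (h₂ : ∀ i, Code.prodCoprod₂Coeff a i = 0) : InducesConfluentSystem a := by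
  intro m n
  refine confluent_of_normalize_eq fun M r r' hr hr' => ?_
  induction M using Quotient.inductionOn with | h G =>
  obtain ⟨f, hf⟩ := monomialRule_mk.1 hr
  obtain ⟨g, hg⟩ := monomialRule_mk.1 hr'
  rcases chain_or_eq hf.redex hg.redex with rfl | hfg | hgf
  · rw [hf.unique hg]
  · obtain ⟨G', hG', e₁, e₂⟩ := exists_chain_of_ruleAt hf hg hfg
    exact normalize_eq_of_isChain h₁ h₂ hG' e₁ e₂
  · obtain ⟨G', hG', e₁, e₂⟩ := exists_chain_of_ruleAt hg hf hgf
    exact (normalize_eq_of_isChain h₁ h₂ hG' e₁ e₂).symm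

theorem eq_of_reducesTo_of_confluent (h : InducesConfluentSystem a) {c : Code m n}
    {u v u' v' : Fin 3} {y y' : FreeProperad 3 m n}
    (hy : c.ReducesTo a (Equiv.refl _) (Equiv.refl _) u v y)
    (hy' : c.ReducesTo a (Equiv.refl _) (Equiv.refl _) u' v' y') : y = y' := by
  obtain ⟨_, hc, r, hr, rfl⟩ := hy
  obtain ⟨_, hc', r', hr', rfl⟩ := hy'
  exact normalize_eq_of_confluent (h m n) hr.monomialRule hr'.monomialRule

/-- Irreducible monomials are their own normal forms, and pairwise non-isomorphic ones are distinct
basis vectors; evaluation at one of them isolates its coefficient. -/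
theorem coeff_eq_zero_of_sum_eq_zero {k : ℕ} {A : Fin k → Code m n} {coeff : Fin k → ℂ}
    (hA : ∀ i, (A i).Valid ∧ (A i).Normal) (hne : ∀ i j, (A i).Iso (A j) → i = j)
    (h : ∑ i, coeff i • (A i).nf a (Equiv.refl _) (Equiv.refl _) = 0) (i : Fin k) :
    coeff i = 0 := by
  have key := DFunLike.congr_fun h (Quotient.mk _ ((A i).graph (hA i).1))
  rw [Finsupp.finsetSum_apply, Finset.sum_eq_single i] at key
  · simpa [Code.nf_of_normal a (hA i).2 (hA i).1, Graph.toFree] using key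
  · intro j _ hj
    rw [Code.nf_of_normal a (hA j).2 (hA j).1, Graph.toFree, Finsupp.smul_apply,
      Finsupp.single_eq_of_ne, smul_zero]
    intro e
    exact hj (hne j i (Quotient.exact e.symm))
  · simp

/-- Confluence equates the normal forms of the two branches of each mixed critical pair. Their
difference is a combination of eight monomials checked to be irreducible and pairwise
non-isomorphic. -/
theorem coeff_eq_zero_of_inducesConfluentSystem (h : InducesConfluentSystem a) :
    (∀ i, Code.prod₂coprodCoeff a i = 0) ∧ ∀ i, Code.prodCoprod₂Coeff a i = 0 := by
  constructor
  · refine coeff_eq_zero_of_sum_eq_zero (a := a) (A := Code.prod₂coprodNormal) (by decide +kernel)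
      (by decide +kernel) ?_
    have key := eq_of_reducesTo_of_confluent h (reducesTo_prod₂coprod a _ _).1
      (reducesTo_prod₂coprod a _ _).2
    rw [Code.nf_prod₂coprod] at key
    simpa using key
  · refine coeff_eq_zero_of_sum_eq_zero (a := a) (A := Code.prodCoprod₂Normal) (by decide +kernel)
      (by decide +kernel) ?_
    have key := eq_of_reducesTo_of_confluent h (reducesTo_prodCoprod₂ a _ _).1
      (reducesTo_prodCoprod₂ a _ _).2
    rw [Code.nf_prodCoprod₂] at key
    simpa using key

theorem inducesConfluentSystem_iff (a : Fin 4 → ℂ) :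
    InducesConfluentSystem a ↔ (∀ i, a i = a i ^ 2) ∧
      a 0 * a 2 = 0 ∧ a 0 * a 3 = 0 ∧ a 1 * a 2 = 0 ∧ a 1 * a 3 = 0 := by
  constructor
  · intro h
    obtain ⟨h₁, h₂⟩ := coeff_eq_zero_of_inducesConfluentSystem h
    refine ⟨fun i => ?_, ?_, ?_, ?_, ?_⟩
    · fin_cases i
      · exact sub_eq_zero.1 (h₁ 0)
      · exact (sub_eq_zero.1 (h₁ 1)).symm
      · exact sub_eq_zero.1 (h₁ 2)
      · exact (sub_eq_zero.1 (h₁ 3)).symm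
    -- Either mixed pair yields all the idempotency equations, but each yields only two of the four
    -- product equations, so both are needed.
    · exact neg_eq_zero.1 (h₁ 6)
    · exact h₂ 4
    · exact neg_eq_zero.1 (h₂ 6)
    · exact h₁ 4
  · rintro ⟨h, h₁, h₂, h₃, h₄⟩
    refine inducesConfluentSystem_of_coeff_eq_zero (fun i => ?_) fun i => ?_
    · fin_cases i <;> simp [Code.prod₂coprodCoeff, ← h, h₁, h₄]
    · fin_cases i <;> simp [Code.prodCoprod₂Coeff, ← h, h₂, h₃]

theorem mem_setC_iff (a : Fin 4 → ℂ) :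
    (a ∈ setC ∧ ![a 1, a 0, a 2, a 3] ∈ setC) ↔ (∀ i, a i = a i ^ 2) ∧
      a 0 * a 2 = 0 ∧ a 0 * a 3 = 0 ∧ a 1 * a 2 = 0 ∧ a 1 * a 3 = 0 := by
  simp only [setC, Set.mem_ofPred_eq, Fin.forall_fin_succ, Matrix.cons_val]
  simp
  tauto

end Criterion

end Properad

theorem mainTheorem6 (a : Fin 4 → ℂ) :
    (Properad.InducesConfluentSystem a ↔
      a ∈ Properad.setC ∧ ![a 1, a 0, a 2, a 3] ∈ Properad.setC) ∧
    (Properad.InducesConfluentSystem a ↔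
      (∀ i, a i = a i ^ 2) ∧
        a 0 * a 2 = 0 ∧ a 0 * a 3 = 0 ∧ a 1 * a 2 = 0 ∧ a 1 * a 3 = 0) :=
  ⟨(Properad.inducesConfluentSystem_iff a).trans (Properad.mem_setC_iff a).symm,
    Properad.inducesConfluentSystem_iff a⟩
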